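/- **Data.** For $\mu\in[0,1]$ let $\mathcal P(\mu)$ be the law of $(x,y,a)$ where $y$ is uniform on $\{1,-1\}$, $a\in\{1,-1\}$ with $\Pr(a=y\mid y)=\mu$, and, given $(y,a)$, the input $x=[x_1,x_2,\xi]^\top\in\mathbb R^d$ has independent components $x_1\sim\mathcal N(y,\sigma_1^2)$, $x_2=a$ and $\xi\sim\mathcal N\big(0,\tfrac{\sigma_\xi^2}{d-2}I_{d-2}\big)$. Fix $p\in(\tfrac12,1]$, $s\in[0,1]$, $\lambda>0$, $r>0$, $\sigma_1\ge 0$. **Training.** Let $\mathcal D_{\rm FT}=\{(x_i,y_i,a_i)\}_{i\le n}$ be i.i.d. from $\mathcal P(p)$ and, independently, $\mathcal D_{\rm known}=\{(x'_j,y'_j,a'_j)\}_{j\le m}$ i.i.d. from $\mathcal P(\tfrac12)$. Given these, choose independently for each $i\le n$ an index $J_i$ uniformly from $\{j: y'_j=y_i\}$ (uniformly from $\{1,\dots,m\}$ if this set is empty), and let $\mathcal D_{\rm Mixed}=\{(\tilde x_i,y_i)\}_{i\le n}$ with $\tilde x_i=(1-s)x_i+s\,x'_{J_i}$. Let $w^*$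 be the minimizer over $w\in\mathbb R^d$ of $$\frac1n\sum_{i=1}^n(\tilde x_i^\top w-y_i)^2+\lambda\|w\|^2 ,$$ and let $\mathcal L^{test}_{wg}(w)=\mathbb E\big[(x^\top w-y)^2\mid a\ne y\big]$ for $(x,y,a)\sim\mathcal P(\mu)$; this is the same for every $\mu\in[0,1)$. **Claim.** Let $q=\frac{\lambda}{s^2r+\lambda}$ and $$\begin{aligned} \psi_1&=(1-s)^2(1+\sigma_1^2)+2s(1-s)q+s^2q(1+\sigma_1^2)-(1-s)^2(1-q)+\lambda,\\ \psi_2&=(1-s)^2(2p-1)+s(1-s)q(2p-1)-(1-s)^2(1-q)(2p-1),\\ \psi_3&=(1-s)^2+s^2q-(1-s)^2(1-q)(2p-1)^2+\lambda,\\ \mathcal L_\infty&=\Big(\tfrac{q}{\psi_1\psi_3-\psi_2^2}\big(\psi_3+\psi_2-(\psi_1+\psi_2)(1-s)(2p-1)\big)-1\Big)^2+\sigma_1^2\Big(\tfrac{q}{\psi_1\psi_3-\psi_2^2}\big(\psi_3-\psi_2(1-s)(2p-1)\big)\Big)^2 . \end{aligned}$$ Along every sequence $(n_k,d_k,m_k,\sigma_{\xi,k})$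 with $n_k,d_k,m_k\to\infty$, $n_k/d_k\to\infty$, $d_k/m_k\to\infty$ and $\sigma_{\xi,k}^2/m_k=r$ for all $k$, one has $\mathcal L^{test}_{wg}(w^*)\to\mathcal L_\infty$ in probability. If moreover $\sum_k\big(\tfrac1{m_k}+\tfrac{m_k}{d_k}+\tfrac{d_k}{n_k}\big)<\infty$, then, for training runs defined on a common probability space with an arbitrary joint law, the convergence is almost sure. -/

import Mathlib

open MeasureTheory ProbabilityTheory Filter
open scoped NNReal ENNReal Topology

namespace Dispel

noncomputable section

/-- Labels and spurious attributes live in `{1, -1}`, coded by `Bool`: `true` is `1`, `false` is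
`-1`. -/
def sgn (b : Bool) : ℝ := if b then 1 else -1

/-- An example `(x, y, a)`: input in `ℝ^d`, label, spurious attribute. -/
abbrev Example (d : ℕ) : Type := (Fin d → ℝ) × Bool × Bool

/-- The input `x` of an example. -/
abbrev Example.input {d : ℕ} (e : Example d) : Fin d → ℝ := e.1

/-- The label `y` of an example. -/
abbrev Example.label {d : ℕ} (e : Example d) : Bool := e.2.1

/-- The spurious attribute `a` of an example. -/
abbrev Example.attr {d : ℕ} (e : Example d) : Bool := e.2.2

/-- Mean of the coordinates of `x` given `y` and `a`: `(y, a, 0, …, 0)`. -/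
def coordMean {d : ℕ} (y a : Bool) (i : Fin d) : ℝ :=
  if (i : ℕ) = 0 then sgn y else if (i : ℕ) = 1 then sgn a else 0

/-- Variance of the coordinates of `x` given `y` and `a`:
`(σ₁², σ₂², σξ² / (d - 2), …, σξ² / (d - 2))`. -/
def coordVar {d : ℕ} (σ₁ σ₂ σξ : ℝ≥0) (i : Fin d) : ℝ≥0 :=
  if (i : ℕ) = 0 then σ₁ ^ 2 else if (i : ℕ) = 1 then σ₂ ^ 2 else σξ ^ 2 / ((d - 2 : ℕ) : ℝ≥0)

/-- The law of the input `x` given `y` and `a`: independent Gaussian coordinates. A Gaussian of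
variance `0` is the point mass at its mean. -/
def inputLaw (d : ℕ) (σ₁ σ₂ σξ : ℝ≥0) (y a : Bool) : Measure (Fin d → ℝ) :=
  Measure.pi fun i => gaussianReal (coordMean y a i) (coordVar σ₁ σ₂ σξ i)

/-- The distribution `P(μ)`: `y` is uniform, `a = y` with probability `μ`, and `x` has law
`inputLaw` given `y` and `a`. -/
def dataLaw (d : ℕ) (σ₁ σ₂ σξ : ℝ≥0) (μ : ℝ) : Measure (Example d) :=
  ∑ y : Bool, ∑ a : Bool, ENNReal.ofReal (1 / 2 * if a = y then μ else 1 - μ) •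
    (inputLaw d σ₁ σ₂ σξ y a).prod (Measure.dirac (y, a))

/-- Given the labels `y` of the `n` fine-tuning examples and the labels `y'` of the `m` known
examples, the law of the indices of the known examples that are selected: independently for each
`i`, uniform on the known examples with label `y i`, or on all of them if there are none. -/
def selectLaw {n m : ℕ} (y : Fin n → Bool) (y' : Fin m → Bool) : Measure (Fin n → Fin m) :=
  open scoped Classical in
  Measure.pi fun i =>
    if ∃ j, y' j = y i then uniformOn {j | y' j = y i} else uniformOn Set.univ

/-- `selectLaw` as a kernel. -/
def selectKernel (n m : ℕ) : Kernel ((Fin n → Bool) × (Fin m → Bool)) (Fin n → Fin m) :=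
  Kernel.ofFunOfCountable fun ys => selectLaw ys.1 ys.2

/-- A fine-tuning data set of size `n` and a known data set of size `m`. -/
abbrev DataSets (n d m : ℕ) : Type := (Fin n → Example d) × (Fin m → Example d)

/-- The labels in the two data sets. -/
def labels {n d m : ℕ} (D : DataSets n d m) : (Fin n → Bool) × (Fin m → Bool) :=
  (fun i => (D.1 i).label, fun j => (D.2 j).label)

lemma measurable_labels {n d m : ℕ} : Measurable (labels : DataSets n d m → _) := by
  unfold labels Example.label
  fun_prop

/-- All the randomness of one training run: the two data sets, and for each fine-tuning example
the index of the known example it is mixed with. -/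
abbrev Trial (n d m : ℕ) : Type := DataSets n d m × (Fin n → Fin m)

/-- The law of a training run: `n` i.i.d. examples from `P(p)`, independently `m` i.i.d. examples
from `P(1/2)`, and then the random selection given the labels. -/
def trialLaw (n d m : ℕ) (σ₁ σ₂ σξ : ℝ≥0) (p : ℝ) : Measure (Trial n d m) :=
  ((Measure.pi fun _ : Fin n => dataLaw d σ₁ σ₂ σξ p).prod
    (Measure.pi fun _ : Fin m => dataLaw d σ₁ σ₂ σξ (1 / 2))) ⊗ₘ
    ((selectKernel n m).comap labels measurable_labels)

/-- The `i`-th input of the mixed data set (every example is mixed); its label is that of the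
`i`-th fine-tuning example. -/
def mixedInput {n d m : ℕ} (s : ℝ) (T : Trial n d m) (i : Fin n) : Fin d → ℝ :=
  (1 - s) • (T.1.1 i).input + s • (T.1.2 (T.2 i)).input

/-- Mean squared error on the mixed data set plus the squared Euclidean norm times `lam`. -/
def trainLoss {n d m : ℕ} (s lam : ℝ) (T : Trial n d m) (w : Fin d → ℝ) : ℝ :=
  (∑ i, (mixedInput s T i ⬝ᵥ w - sgn (T.1.1 i).label) ^ 2) / n + lam * ∑ l, w l ^ 2

/-- Worst-group test loss of `w`: the expectation of `(xᵀw - y)²` under `P(μ)` given `a ≠ y`. -/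
def testLoss (d : ℕ) (σ₁ σ₂ σξ : ℝ≥0) (μ : ℝ) (w : Fin d → ℝ) : ℝ :=
  ∫ e, (e.input ⬝ᵥ w - sgn e.label) ^ 2
    ∂(cond (dataLaw d σ₁ σ₂ σξ μ) {e : Example d | e.attr ≠ e.label})

def q (s r lam : ℝ) : ℝ := lam / (s ^ 2 * r + lam)

def ψ₁ (s r lam σ₁ : ℝ) : ℝ :=
  (1 - s) ^ 2 * (1 + σ₁ ^ 2) + 2 * s * (1 - s) * q s r lam + s ^ 2 * q s r lam * (1 + σ₁ ^ 2)
    - (1 - s) ^ 2 * (1 - q s r lam) + lam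

def ψ₂ (s p r lam : ℝ) : ℝ :=
  (1 - s) ^ 2 * (2 * p - 1) + s * (1 - s) * q s r lam * (2 * p - 1)
    - (1 - s) ^ 2 * (1 - q s r lam) * (2 * p - 1)

def ψ₃ (s p r lam : ℝ) : ℝ :=
  (1 - s) ^ 2 + s ^ 2 * q s r lam - (1 - s) ^ 2 * (1 - q s r lam) * (2 * p - 1) ^ 2 + lam

/-- The closed form of the limiting worst-group test loss. -/
def limitLoss (s p r lam σ₁ : ℝ) : ℝ :=
  let q := q s r lam
  let ψ₁ := ψ₁ s r lam σ₁
  let ψ₂ := ψ₂ s p r lam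
  let ψ₃ := ψ₃ s p r lam
  (q / (ψ₁ * ψ₃ - ψ₂ ^ 2) * (ψ₃ + ψ₂ - (ψ₁ + ψ₂) * (1 - s) * (2 * p - 1)) - 1) ^ 2
    + σ₁ ^ 2 * (q / (ψ₁ * ψ₃ - ψ₂ ^ 2) * (ψ₃ - ψ₂ * (1 - s) * (2 * p - 1))) ^ 2

end

end Dispel

/-!
Multiplying every input by its label turns all responses into `1` and makes the inputs independent
of the labels. In these signed inputs the core coordinates of the trained weights have deterministic
limits, which solve the normal equations of a two-dimensional problem, while the noise coordinates
do a ridge fit, through the nearly orthogonal noise of the known examples, to the residuals these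
examples leave. This describes an explicit comparison vector. The training loss is strongly convex
with modulus `lam`, so the squared distance from the trained weights to the comparison vector is at
most `2 / lam` times the mean squared error made in approximating its residuals plus `4 / lam ^ 2`
times the squared norm of an approximate gradient there. All terms are polynomials in independent
coordinates with explicit second moments, and their expectation given the selection `J` is
`O(1 / m + m / d + m / n)` plus `m` times the squared distance between the selection frequencies and
the uniform distribution, which is `O(1 / m + 1 / n)` on average. The noise contributes at most
`r (m / (d - 2)) / lam` to the test loss, so Markov's inequality bounds the probability of a given
deviation by a multiple of `1 / m + m / d + d / n`, and the Borel–Cantelli lemma upgrades a summable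
rate to almost sure convergence.
-/

namespace Dispel

/-- A real function with finite absolute moments of all orders. This class of functions is closed
under the ring operations, so that `fun_prop` discharges every integrability condition below. -/
@[fun_prop]
def HasMoments {Ω : Type*} [MeasurableSpace Ω] (f : Ω → ℝ) (P : Measure Ω) : Prop :=
  ∀ p : ℝ≥0∞, p ≠ ∞ → MemLp f p P

namespace HasMoments

variable {Ω : Type*} [MeasurableSpace Ω] {P : Measure Ω} {f g : Ω → ℝ}

theorem integrable (hf : HasMoments f P) : Integrable f P :=
  memLp_one_iff_integrable.1 (hf 1 ENNReal.one_ne_top)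

@[fun_prop]
theorem const [IsFiniteMeasure P] (c : ℝ) : HasMoments (fun _ : Ω => c) P :=
  fun _ _ => memLp_const c

@[fun_prop]
theorem add (hf : HasMoments f P) (hg : HasMoments g P) : HasMoments (fun x => f x + g x) P :=
  fun p hp => (hf p hp).add (hg p hp)

@[fun_prop]
theorem sub (hf : HasMoments f P) (hg : HasMoments g P) : HasMoments (fun x => f x - g x) P :=
  fun p hp => (hf p hp).sub (hg p hp)

@[fun_prop]
theorem mul (hf : HasMoments f P) (hg : HasMoments g P) : HasMoments (fun x => f x * g x) P := by
  intro p hp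
  have : ENNReal.HolderTriple (2 * p) (2 * p) p := ⟨by
    rw [ENNReal.mul_inv (by simp) (by simp), ← add_mul, ENNReal.inv_two_add_inv_two, one_mul]⟩
  have h2 : 2 * p ≠ ∞ := ENNReal.mul_ne_top (by simp) hp
  exact MemLp.mul' (hg _ h2) (hf _ h2)

@[fun_prop]
theorem div_const (hf : HasMoments f P) (c : ℝ) : HasMoments (fun x => f x / c) P := by
  simp_rw [div_eq_mul_inv]
  exact fun p hp => (hf p hp).mul_const _

@[fun_prop]
theorem pow [IsFiniteMeasure P] (hf : HasMoments f P) (k : ℕ) :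
    HasMoments (fun x => f x ^ k) P := by
  induction k with
  | zero => simpa only [pow_zero] using const 1
  | succ k ih => simpa only [pow_succ] using ih.mul hf

@[fun_prop]
theorem sum {κ : Type*} (S : Finset κ) {F : κ → Ω → ℝ}
    (hF : ∀ i, HasMoments (F i) P) : HasMoments (fun x => ∑ i ∈ S, F i x) P :=
  fun p hp => memLp_finsetSum S fun i _ => hF i p hp

theorem integral_sum {κ : Type*} (S : Finset κ) {F : κ → Ω → ℝ}
    (hF : ∀ i, HasMoments (F i) P) : ∫ x, ∑ i ∈ S, F i x ∂P = ∑ i ∈ S, ∫ x, F i x ∂P :=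
  integral_finsetSum S fun i _ => (hF i).integrable

theorem integral_sum_mul_sum {ι κ : Type*} {f : ι → Ω → ℝ} {g : κ → Ω → ℝ}
    (S : Finset ι) (S' : Finset κ) (hf : ∀ i, HasMoments (f i) P) (hg : ∀ i, HasMoments (g i) P) :
    ∫ x, (∑ i ∈ S, f i x) * ∑ j ∈ S', g j x ∂P = ∑ i ∈ S, ∑ j ∈ S', ∫ x, f i x * g j x ∂P := by
  simp_rw [Finset.sum_mul_sum]
  rw [integral_sum S fun i => by fun_prop]
  exact Finset.sum_congr rfl fun i _ => integral_sum S' fun j => by fun_prop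

theorem integral_sq_sum_of_orthogonal {κ : Type*} (S : Finset κ) {f : κ → Ω → ℝ}
    (hf : ∀ i, HasMoments (f i) P) (h : ∀ i ∈ S, ∀ j ∈ S, i ≠ j → ∫ x, f i x * f j x ∂P = 0) :
    ∫ x, (∑ i ∈ S, f i x) ^ 2 ∂P = ∑ i ∈ S, ∫ x, f i x ^ 2 ∂P := by
  simp_rw [sq]
  rw [integral_sum_mul_sum S S hf hf]
  exact Finset.sum_congr rfl fun i hi =>
    Finset.sum_eq_single i (fun j hj hji => h i hi j hj hji.symm) (absurd hi)

variable [IsFiniteMeasure P]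

theorem integral_sq_add_le (hf : HasMoments f P) (hg : HasMoments g P) :
    ∫ x, (f x + g x) ^ 2 ∂P ≤ 2 * ∫ x, f x ^ 2 ∂P + 2 * ∫ x, g x ^ 2 ∂P := by
  rw [← integral_const_mul, ← integral_const_mul, ← integral_add
    (HasMoments.integrable (by fun_prop)) (HasMoments.integrable (by fun_prop))]
  refine integral_mono (HasMoments.integrable (by fun_prop))
    (HasMoments.integrable (by fun_prop)) fun x => ?_
  linarith [two_mul_le_add_sq (f x) (g x), add_sq (f x) (g x)]

theorem integral_mul_le (hf : HasMoments f P) (hg : HasMoments g P) {V : ℝ}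
    (hfV : ∫ x, f x ^ 2 ∂P ≤ V) (hgV : ∫ x, g x ^ 2 ∂P ≤ V) : ∫ x, f x * g x ∂P ≤ V := by
  calc ∫ x, f x * g x ∂P
      ≤ ∫ x, (f x ^ 2 / 2 + g x ^ 2 / 2) ∂P :=
        integral_mono (HasMoments.integrable (by fun_prop))
          (HasMoments.integrable (by fun_prop)) fun x => by
            linarith [two_mul_le_add_sq (f x) (g x)]
    _ = (∫ x, f x ^ 2 ∂P) / 2 + (∫ x, g x ^ 2 ∂P) / 2 := by
        rw [integral_add (HasMoments.integrable (by fun_prop))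
          (HasMoments.integrable (by fun_prop)), integral_div, integral_div]
    _ ≤ V := by linarith

theorem integral_sq_sum_le_of_fiberwise_orthogonal {κ β : Type*} [Fintype κ] [Fintype β]
    [DecidableEq β] (J : κ → β) {f : κ → Ω → ℝ} (hf : ∀ i, HasMoments (f i) P)
    (h : ∀ i j, J i ≠ J j → ∫ x, f i x * f j x ∂P = 0)
    {V : ℝ} (hV : ∀ i, ∫ x, f i x ^ 2 ∂P ≤ V) :
    ∫ x, (∑ i, f i x) ^ 2 ∂P ≤ V * ∑ b, ((Finset.univ.filter fun i => J i = b).card : ℝ) ^ 2 := by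
  let F := fun b => Finset.univ.filter fun i => J i = b
  have hfiber (b : β) : ∫ x, (∑ i ∈ F b, f i x) ^ 2 ∂P ≤ V * ((F b).card : ℝ) ^ 2 := by
    simp_rw [sq]
    rw [integral_sum_mul_sum _ _ hf hf]
    calc ∑ i ∈ F b, ∑ j ∈ F b, ∫ x, f i x * f j x ∂P ≤ ∑ _i ∈ F b, ∑ _j ∈ F b, V :=
          Finset.sum_le_sum fun i _ => Finset.sum_le_sum fun j _ =>
            integral_mul_le (hf i) (hf j) (hV i) (hV j)
      _ = V * ((F b).card * (F b).card) := by simp only [Finset.sum_const, nsmul_eq_mul]; ring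
  have horth (b : β) (_ : b ∈ Finset.univ) (b' : β) (_ : b' ∈ Finset.univ) (hbb' : b ≠ b') :
      ∫ x, (∑ i ∈ F b, f i x) * ∑ j ∈ F b', f j x ∂P = 0 := by
    rw [integral_sum_mul_sum _ _ hf hf]
    refine Finset.sum_eq_zero fun i hi => Finset.sum_eq_zero fun j hj => h i j ?_
    rwa [(Finset.mem_filter.1 hi).2, (Finset.mem_filter.1 hj).2]
  simp_rw [← Finset.sum_fiberwise Finset.univ J, Finset.mul_sum]
  rw [integral_sq_sum_of_orthogonal Finset.univ (fun b => by fun_prop) horth]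
  exact Finset.sum_le_sum fun b _ => hfiber b

end HasMoments

/-- A measure on the line with moments of all orders. -/
class AllMoments (μ : Measure ℝ) : Prop where
  hasMoments_id : HasMoments (fun x => x) μ

section Pi

theorem integral_mul_of_dependsOn {ι : Type*} [Fintype ι] {X : ι → Type*}
    [∀ i, MeasurableSpace (X i)] (μ : ∀ i, Measure (X i)) [∀ i, IsProbabilityMeasure (μ i)]
    (S : Set ι) {F G : (∀ i, X i) → ℝ} (hF : DependsOn F S) (hG : DependsOn G Sᶜ) :
    ∫ x, F x * G x ∂Measure.pi μ = (∫ x, F x ∂Measure.pi μ) * ∫ x, G x ∂Measure.pi μ := by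
  classical
  have he := measurePreserving_piEquivPiSubtypeProd μ (· ∈ S)
  obtain ⟨F', rfl⟩ := dependsOn_iff_exists_comp.1 hF
  obtain ⟨G', rfl⟩ := dependsOn_iff_exists_comp.1 hG
  have hFG := (he.integral_comp' fun z => F' z.1 * G' z.2).trans (integral_prod_mul F' G')
  have hF' := (he.integral_comp' fun z => F' z.1).trans (integral_fun_fst F')
  have hG' := (he.integral_comp' fun z => G' z.2).trans (integral_fun_snd G')
  rw [probReal_univ, one_smul] at hF' hG'
  exact hFG.trans (congr_arg₂ _ hF'.symm hG'.symm)

theorem measurePreserving_comp_of_injective {ι κ : Type*} [Fintype ι] [Fintype κ]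
    {X : Type*} [MeasurableSpace X] (μ : ι → Measure X) [∀ i, IsProbabilityMeasure (μ i)]
    {e : κ → ι} (he : Function.Injective e) :
    MeasurePreserving (fun x : ι → X => x ∘ e) (Measure.pi μ) (Measure.pi fun k => μ (e k)) := by
  refine ⟨by unfold Function.comp; fun_prop, ?_⟩
  have hindep := (iIndepFun_pi (μ := μ) (X := fun _ x => x) fun i => aemeasurable_id).precomp he
  rw [iIndepFun_iff_map_fun_eq_pi_map fun k => (measurable_pi_apply _).aemeasurable] at hindep
  exact hindep.trans (congr_arg _ (funext fun k => (measurePreserving_eval μ (e k)).map_eq))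

variable {ι κ : Type*} [Fintype ι] (μ : ι → Measure ℝ) [∀ i, IsProbabilityMeasure (μ i)]

@[fun_prop]
theorem HasMoments.eval [∀ i, AllMoments (μ i)] (k : ι) :
    HasMoments (fun x : ι → ℝ => x k) (Measure.pi μ) := fun p hp =>
  (AllMoments.hasMoments_id p hp).comp_measurePreserving (measurePreserving_eval μ k)

theorem integral_comp_eval_pi (k : ι) {φ : ℝ → ℝ} (hφ : Measurable φ) :
    ∫ x : ι → ℝ, φ (x k) ∂Measure.pi μ = ∫ t, φ t ∂μ k :=
  (measurePreserving_eval μ k).hasLaw.integral_comp hφ.aestronglyMeasurable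

section Update

variable [DecidableEq ι]

theorem integral_eval_mul_of_update (k : ι) {φ : ℝ → ℝ} (hφ : Measurable φ)
    {f : (ι → ℝ) → ℝ} (hf : ∀ x t, f (Function.update x k t) = f x) :
    ∫ x, φ (x k) * f x ∂Measure.pi μ = (∫ t, φ t ∂μ k) * ∫ x, f x ∂Measure.pi μ := by
  rw [integral_mul_of_dependsOn μ {k} (F := fun x => φ (x k)) (G := f),
    integral_comp_eval_pi μ k hφ]
  · intro x y h
    exact congr_arg φ (h k rfl)
  · intro x y h
    rw [← hf x (y k)]
    exact congr_arg f (Function.update_eq_iff.2 ⟨rfl, fun i hi => h i hi⟩)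

theorem integral_sq_sum_eval_mul (S : Finset κ) {e : κ → ι}
    (he : Function.Injective e) {φ : κ → ℝ → ℝ} (hφ : ∀ i, Measurable (φ i))
    (hφm : ∀ i, HasMoments (fun x : ι → ℝ => φ i (x (e i))) (Measure.pi μ))
    (h0 : ∀ i, ∫ t, φ i t ∂μ (e i) = 0) {f : κ → (ι → ℝ) → ℝ}
    (hfm : ∀ i, HasMoments (f i) (Measure.pi μ))
    (hf : ∀ i ∈ S, ∀ j ∈ S, ∀ x t, f i (Function.update x (e j) t) = f i x) :
    ∫ x, (∑ i ∈ S, φ i (x (e i)) * f i x) ^ 2 ∂Measure.pi μ =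
      ∑ i ∈ S, (∫ t, φ i t ^ 2 ∂μ (e i)) * ∫ x, f i x ^ 2 ∂Measure.pi μ := by
  rw [HasMoments.integral_sq_sum_of_orthogonal S fun i => (hφm i).mul (hfm i)]
  · refine Finset.sum_congr rfl fun i hi => ?_
    rw [← integral_eval_mul_of_update μ (e i) (φ := fun t => φ i t ^ 2) (by fun_prop)]
    · simp_rw [mul_pow]
    · intro x t; rw [hf i hi i hi]
  · intro i hi j hj hij
    have := integral_eval_mul_of_update μ (e i) (hφ i)
      (f := fun x => f i x * (φ j (x (e j)) * f j x)) fun x t => by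
        rw [hf i hi i hi, hf j hj i hi, Function.update_of_ne (he.ne hij.symm)]
    rw [h0, zero_mul] at this
    rw [← this]
    exact integral_congr_ae (.of_forall fun x => by ring)

theorem integral_sub_mul_sub_pi {c v : ι → ℝ}
    (hc : ∀ i, ∫ t, (t - c i) ∂μ i = 0) (hv : ∀ i, ∫ t, (t - c i) ^ 2 ∂μ i = v i) (i j : ι) :
    ∫ x : ι → ℝ, (x i - c i) * (x j - c j) ∂Measure.pi μ = if i = j then v i else 0 := by
  split_ifs with hij
  · subst hij
    simp_rw [← sq]
    rw [integral_comp_eval_pi μ i (φ := fun t => (t - c i) ^ 2) (by fun_prop), hv]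
  · rw [integral_eval_mul_of_update μ i (φ := fun t => t - c i) (by fun_prop), hc, zero_mul]
    intro x t
    rw [Function.update_of_ne (Ne.symm hij)]

end Update

theorem integral_affine_mul_affine_pi [∀ i, AllMoments (μ i)] {c v : ι → ℝ}
    (hc : ∀ i, ∫ t, (t - c i) ∂μ i = 0) (hv : ∀ i, ∫ t, (t - c i) ^ 2 ∂μ i = v i)
    (α₀ β₀ : ℝ) (α β : ι → ℝ) :
    ∫ x : ι → ℝ, (α₀ + ∑ i, α i * (x i - c i)) * (β₀ + ∑ i, β i * (x i - c i)) ∂Measure.pi μ =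
      α₀ * β₀ + ∑ i, α i * β i * v i := by
  classical
  have hlin (γ : ι → ℝ) : ∫ x : ι → ℝ, (∑ i, γ i * (x i - c i)) ∂Measure.pi μ = 0 := by
    rw [HasMoments.integral_sum _ fun i => by fun_prop]
    refine Finset.sum_eq_zero fun i _ => ?_
    rw [integral_const_mul, integral_comp_eval_pi μ i (φ := fun t => t - c i) (by fun_prop), hc,
      mul_zero]
  have hquad : ∫ x : ι → ℝ, (∑ i, α i * (x i - c i)) * ∑ i, β i * (x i - c i) ∂Measure.pi μ =
      ∑ i, α i * β i * v i := by
    rw [HasMoments.integral_sum_mul_sum _ _ (fun i => by fun_prop) fun i => by fun_prop]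
    simp_rw [mul_mul_mul_comm (α _), integral_const_mul, integral_sub_mul_sub_pi μ hc hv, mul_ite,
      mul_zero, Finset.sum_ite_eq, Finset.mem_univ, if_true]
  simp_rw [add_mul, mul_add]
  rw [integral_add (HasMoments.integrable (by fun_prop)) (HasMoments.integrable (by fun_prop)),
    integral_add (HasMoments.integrable (by fun_prop)) (HasMoments.integrable (by fun_prop)),
    integral_add (HasMoments.integrable (by fun_prop)) (HasMoments.integrable (by fun_prop)),
    integral_const, integral_const_mul, integral_mul_const, hlin, hlin, hquad]
  simp

end Pi

theorem neg_dotProduct_le {κ : Type*} [Fintype κ] {lam : ℝ} (hlam : 0 < lam) (g h : κ → ℝ) :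
    -(g ⬝ᵥ h) ≤ lam / 4 * ∑ l, h l ^ 2 + 1 / lam * ∑ l, g l ^ 2 := by
  rw [dotProduct, ← Finset.sum_neg_distrib, Finset.mul_sum, Finset.mul_sum,
    ← Finset.sum_add_distrib]
  refine Finset.sum_le_sum fun l _ => ?_
  have hsq : 0 ≤ 1 / lam * (g l + lam / 2 * h l) ^ 2 := by positivity
  have : 1 / lam * (g l + lam / 2 * h l) ^ 2 =
      1 / lam * g l ^ 2 + g l * h l + lam / 4 * h l ^ 2 := by
    field_simp
    ring
  linarith

theorem sum_sub_sq_le_of_ridge_le {ι κ : Type*} [Fintype ι] [Fintype κ] (X : Matrix ι κ ℝ)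
    (y R δ : ι → ℝ) {c lam : ℝ} (hc : 0 ≤ c) (hlam : 0 < lam) (w u : κ → ℝ)
    (hres : X.mulVec u - y = R + δ)
    (hle : c * ∑ i, (X i ⬝ᵥ w - y i) ^ 2 + lam * ∑ l, w l ^ 2 ≤
      c * ∑ i, (X i ⬝ᵥ u - y i) ^ 2 + lam * ∑ l, u l ^ 2) :
    ∑ l, (w l - u l) ^ 2 ≤ 2 / lam * (c * ∑ i, δ i ^ 2) +
      4 / lam ^ 2 * ∑ l, (c * ∑ i, X i l * R i + lam * u l) ^ 2 := by
  let g : κ → ℝ := fun l => c * ∑ i, X i l * R i + lam * u l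
  obtain ⟨h, rfl⟩ : ∃ h, w = u + h := ⟨w - u, by abel⟩
  have hgrad : g ⬝ᵥ h = c * R ⬝ᵥ X.mulVec h + lam * u ⬝ᵥ h := by
    have hg : g = c • Matrix.vecMul R X + lam • u := by
      ext l; simp [g, Matrix.vecMul, dotProduct, mul_comm]
    rw [hg, add_dotProduct, smul_dotProduct, smul_dotProduct, ← Matrix.dotProduct_mulVec,
      smul_eq_mul, smul_eq_mul]
  have hδ : -∑ i, δ i ^ 2 ≤ ∑ i, (2 * δ i * X.mulVec h i + X.mulVec h i ^ 2) := by
    rw [← Finset.sum_neg_distrib]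
    exact Finset.sum_le_sum fun i _ => by linarith [sq_nonneg (δ i + X.mulVec h i)]
  have hloss : ∑ i, (X i ⬝ᵥ (u + h) - y i) ^ 2 = ∑ i, (X i ⬝ᵥ u - y i) ^ 2 +
      (2 * R ⬝ᵥ X.mulVec h + ∑ i, (2 * δ i * X.mulVec h i + X.mulVec h i ^ 2)) := by
    rw [dotProduct, Finset.mul_sum, ← Finset.sum_add_distrib, ← Finset.sum_add_distrib]
    refine Finset.sum_congr rfl fun i _ => ?_
    have hi : X i ⬝ᵥ u - y i = R i + δ i := congr_fun hres i
    rw [dotProduct_add, add_sub_right_comm, hi, Matrix.mulVec]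
    ring
  have hnorm : ∑ l, (u + h) l ^ 2 = ∑ l, u l ^ 2 + (2 * u ⬝ᵥ h + ∑ l, h l ^ 2) := by
    rw [dotProduct, Finset.mul_sum, ← Finset.sum_add_distrib, ← Finset.sum_add_distrib]
    exact Finset.sum_congr rfl fun l _ => by rw [Pi.add_apply]; ring
  have hbound : lam / 2 * ∑ l, h l ^ 2 ≤ c * ∑ i, δ i ^ 2 + 2 * (1 / lam * ∑ l, g l ^ 2) := by
    rw [hloss, hnorm] at hle
    linarith [neg_dotProduct_le hlam g h, mul_le_mul_of_nonneg_left hδ hc]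
  calc ∑ l, ((u + h) l - u l) ^ 2 = 2 / lam * (lam / 2 * ∑ l, h l ^ 2) := by
        simp only [Pi.add_apply, add_sub_cancel_left]
        field_simp
    _ ≤ 2 / lam * (c * ∑ i, δ i ^ 2 + 2 * (1 / lam * ∑ l, g l ^ 2)) := by gcongr
    _ = _ := by ring

section Frequencies

variable {n m : ℕ}

/-- The fraction of the fine-tuning examples that are mixed with the `j`-th known example. -/
noncomputable def freq (J : Fin n → Fin m) (j : Fin m) : ℝ :=
  ((Finset.univ.filter fun i => J i = j).card : ℝ) / n

/-- The squared Euclidean distance between the selection frequencies and the uniform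
distribution. -/
noncomputable def freqDev (J : Fin n → Fin m) : ℝ := ∑ j, (freq J j - 1 / m) ^ 2

theorem sum_card_fiber (J : Fin n → Fin m) :
    ∑ j, ((Finset.univ.filter fun i => J i = j).card : ℝ) = n := by
  have := Finset.card_eq_sum_card_fiberwise (f := J) (s := Finset.univ) (t := Finset.univ)
    (fun _ _ => Finset.mem_coe.2 (Finset.mem_univ _))
  rw [Finset.card_univ, Fintype.card_fin] at this
  exact_mod_cast this.symm

theorem sum_freq (hn : 0 < n) (J : Fin n → Fin m) : ∑ j, freq J j = 1 := by
  simp_rw [freq, ← Finset.sum_div, sum_card_fiber]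
  exact div_self (by positivity)

theorem sum_freq_sq (hn : 0 < n) (hm : 0 < m) (J : Fin n → Fin m) :
    ∑ j, freq J j ^ 2 = freqDev J + 1 / m := by
  have : freqDev J = ∑ j, (freq J j ^ 2 - 2 / m * freq J j + 1 / m ^ 2) :=
    Finset.sum_congr rfl fun j _ => by ring
  rw [this, Finset.sum_add_distrib, Finset.sum_sub_distrib, ← Finset.mul_sum, sum_freq hn]
  simp only [Finset.sum_const, Finset.card_univ, Fintype.card_fin, nsmul_eq_mul]
  field_simp
  ring

theorem freqDev_nonneg (J : Fin n → Fin m) : 0 ≤ freqDev J :=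
  Finset.sum_nonneg fun _ _ => sq_nonneg _

end Frequencies

section SampleLaw

/-- The index of a coordinate of one of the inputs: `Sum.inl i` is the `i`-th fine-tuning example
and `Sum.inr j` the `j`-th known example. Coordinates `0` and `1` are called core coordinates, the
other `D` noise coordinates. -/
abbrev CoordIdx (n m D : ℕ) : Type := (Fin n ⊕ Fin m) × Fin (D + 2)

/-- The law of the `k`-th coordinate of an input: `ν` for the core coordinates and `κ` for the noise
coordinates. -/
def coordLaw {D : ℕ} (ν : Fin 2 → Measure ℝ) (κ : Measure ℝ) : Fin (D + 2) → Measure ℝ :=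
  Fin.cons (ν 0) (Fin.cons (ν 1) fun _ => κ)

section CoordLaw

variable {D : ℕ} (ν : Fin 2 → Measure ℝ) (κ : Measure ℝ)

theorem coordLaw_castLE (k : Fin 2) :
    coordLaw ν κ (Fin.castLE (Nat.le_add_left 2 D) k) = ν k := by
  fin_cases k <;> rfl

instance [∀ k, IsProbabilityMeasure (ν k)] [IsProbabilityMeasure κ] (k : Fin (D + 2)) :
    IsProbabilityMeasure (coordLaw ν κ k) := by
  induction k using Fin.cases with
  | zero => exact inferInstanceAs (IsProbabilityMeasure (ν 0))
  | succ k =>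
    induction k using Fin.cases with
    | zero => exact inferInstanceAs (IsProbabilityMeasure (ν 1))
    | succ l => exact inferInstanceAs (IsProbabilityMeasure κ)

instance [∀ k, AllMoments (ν k)] [AllMoments κ] (k : Fin (D + 2)) :
    AllMoments (coordLaw ν κ k) := by
  induction k using Fin.cases with
  | zero => exact inferInstanceAs (AllMoments (ν 0))
  | succ k =>
    induction k using Fin.cases with
    | zero => exact inferInstanceAs (AllMoments (ν 1))
    | succ l => exact inferInstanceAs (AllMoments κ)

end CoordLaw

variable {n m D : ℕ} (ν : Bool → Fin 2 → Measure ℝ) (κ : Measure ℝ)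

/-- The law of all inputs, with independent coordinates: the core coordinates of the fine-tuning
examples have law `ν true`, those of the known examples `ν false`. -/
noncomputable abbrev sampleLaw : Measure (CoordIdx n m D → ℝ) :=
  Measure.pi fun k => coordLaw (ν k.1.isLeft) κ k.2

/-- The law of the core coordinates alone. -/
noncomputable abbrev coreLaw (n m : ℕ) : Measure (CoordIdx n m 0 → ℝ) :=
  Measure.pi fun k => ν k.1.isLeft k.2

variable [∀ b k, IsProbabilityMeasure (ν b k)] [IsProbabilityMeasure κ]

/-- The core coordinates of the fine-tuning examples `f` and of the known examples `g`. -/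
def coreOf {n' m' : ℕ} (f : Fin n' → Fin n) (g : Fin m' → Fin m) (x : CoordIdx n m D → ℝ) :
    CoordIdx n' m' 0 → ℝ :=
  x ∘ Prod.map (Sum.map f g) (Fin.castLE (Nat.le_add_left 2 D))

theorem measurePreserving_coreOf {n' m' : ℕ} {f : Fin n' → Fin n} {g : Fin m' → Fin m}
    (hf : Function.Injective f) (hg : Function.Injective g) :
    MeasurePreserving (coreOf f g : (CoordIdx n m D → ℝ) → _) (sampleLaw ν κ)
      (coreLaw ν n' m') := by
  have h := measurePreserving_comp_of_injective
    (fun k : CoordIdx n m D => coordLaw (ν k.1.isLeft) κ k.2)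
    ((hf.sumMap hg).prodMap (Fin.castLE_injective (Nat.le_add_left 2 D)))
  simp only [Prod.map_fst, Prod.map_snd, Sum.isLeft_map, coordLaw_castLE] at h
  exact h

theorem integral_comp_coreOf {n' m' : ℕ} {f : Fin n' → Fin n} {g : Fin m' → Fin m}
    (hf : Function.Injective f) (hg : Function.Injective g) {φ : (CoordIdx n' m' 0 → ℝ) → ℝ}
    (hφ : Integrable φ (coreLaw ν n' m')) :
    ∫ x : CoordIdx n m D → ℝ, φ (coreOf f g x) ∂sampleLaw ν κ = ∫ z, φ z ∂coreLaw ν n' m' :=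
  (measurePreserving_coreOf ν κ hf hg).hasLaw.integral_comp hφ.aestronglyMeasurable

end SampleLaw

/-- The parameters of the comparison argument: mixing weight `s`, noise level `r`, ridge parameter
`lam`, mean `ρ` of the second core coordinate of a fine-tuning example, and the core coordinates
`a`, `b` of the comparison vector. -/
structure Params where
  s : ℝ
  r : ℝ
  lam : ℝ
  ρ : ℝ
  a : ℝ
  b : ℝ
  r_nonneg : 0 ≤ r
  lam_pos : 0 < lam

namespace Params

noncomputable section

variable {n m D : ℕ} (θ : Params)

/-- The factor by which interpolating the noise of the known examples shrinks their residuals. -/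
def q : ℝ := Dispel.q θ.s θ.r θ.lam

/-- The weight of the residuals of the known examples in the noise coordinates of the comparison
vector. -/
def γ : ℝ := θ.s / (θ.s ^ 2 * θ.r + θ.lam)

/-- The centred part of the residual that comes from a fine-tuning example. -/
def resFt (i : Fin n) (x : CoordIdx n m D → ℝ) : ℝ :=
  (1 - θ.s) * (θ.a * (x (Sum.inl i, 0) - 1) + θ.b * (x (Sum.inl i, 1) - θ.ρ))

/-- The constant part of the residual. -/
def offset : ℝ := θ.a + (1 - θ.s) * θ.ρ * θ.b - 1

/-- The part of the residual determined by the core coordinates of a known example. -/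
def resKnown (j : Fin m) (x : CoordIdx n m D → ℝ) : ℝ :=
  θ.offset + θ.s * (θ.a * (x (Sum.inr j, 0) - 1) + θ.b * x (Sum.inr j, 1))

/-- The noise coordinates of the comparison vector: the ridge solution that fits the noise of the
known examples to `resKnown`. -/
def noiseWeight (l : Fin D) (x : CoordIdx n m D → ℝ) : ℝ :=
  -(θ.γ / m) * ∑ j, x (Sum.inr j, l.succ.succ) * θ.resKnown j x

/-- The vector the trained weights are compared with. -/
def comparison (x : CoordIdx n m D → ℝ) : Fin (D + 2) → ℝ :=
  Fin.cons θ.a (Fin.cons θ.b fun l => θ.noiseWeight l x)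

/-- The mixed inputs, when the `i`-th fine-tuning example is mixed with the known example `J i`. -/
def mix (J : Fin n → Fin m) (x : CoordIdx n m D → ℝ) : Matrix (Fin n) (Fin (D + 2)) ℝ :=
  fun i k => (1 - θ.s) * x (Sum.inl i, k) + θ.s * x (Sum.inr (J i), k)

/-- The main part of the residual of the comparison vector. -/
def mainRes (J : Fin n → Fin m) (i : Fin n) (x : CoordIdx n m D → ℝ) : ℝ :=
  θ.resFt i x + θ.q * θ.resKnown (J i) x

/-- The contribution of the fine-tuning noise to the residual of the comparison vector. -/
def errFt (i : Fin n) (x : CoordIdx n m D → ℝ) : ℝ :=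
  (1 - θ.s) * ∑ l : Fin D, x (Sum.inl i, l.succ.succ) * θ.noiseWeight l x

/-- The deviation of the contribution of the known noise to the residual of the comparison vector
from its limit `-(1 - q) * resKnown`. -/
def errKnown (j : Fin m) (x : CoordIdx n m D → ℝ) : ℝ :=
  θ.s * (∑ l : Fin D, x (Sum.inr j, l.succ.succ) * θ.noiseWeight l x) +
    (1 - θ.q) * θ.resKnown j x

/-- The contribution of one mixed example to a coordinate of `gradMain`. -/
def gradTerm (J : Fin n → Fin m) (k : Fin (D + 2)) (i : Fin n) (x : CoordIdx n m D → ℝ) : ℝ :=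
  θ.mix J x i k * θ.mainRes J i x + θ.lam * θ.comparison x k

/-- Half the gradient of the loss at the comparison vector, with the residual replaced by its main
part. -/
def gradMain (J : Fin n → Fin m) (k : Fin (D + 2)) (x : CoordIdx n m D → ℝ) : ℝ :=
  (n : ℝ)⁻¹ * ∑ i, θ.mix J x i k * θ.mainRes J i x + θ.lam * θ.comparison x k

/-- The bound from strong convexity on the squared distance between the trained weights and the
comparison vector. -/
def distBound (J : Fin n → Fin m) (x : CoordIdx n m D → ℝ) : ℝ :=
  2 / θ.lam * ((n : ℝ)⁻¹ * ∑ i, (θ.errFt i x + θ.errKnown (J i) x) ^ 2) +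
    4 / θ.lam ^ 2 * ∑ k, θ.gradMain J k x ^ 2

theorem one_sub_q : 1 - θ.q = θ.s * θ.γ * θ.r := by
  have := θ.lam_pos
  have := θ.r_nonneg
  simp only [q, Dispel.q, γ]
  field_simp
  ring

theorem lam_mul_γ : θ.lam * θ.γ = θ.s * θ.q := by
  simp only [q, Dispel.q, γ]
  ring

section Deterministic

theorem mix_mulVec_comparison_sub_one (J : Fin n → Fin m) (x : CoordIdx n m D → ℝ) :
    (θ.mix J x).mulVec (θ.comparison x) - 1 =
      (θ.mainRes J · x) + fun i => θ.errFt i x + θ.errKnown (J i) x := by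
  have hdot (e : Fin n ⊕ Fin m) : ∑ k, x (e, k) * θ.comparison x k = x (e, 0) * θ.a +
      (x (e, 1) * θ.b + ∑ l : Fin D, x (e, l.succ.succ) * θ.noiseWeight l x) := by
    simp only [Fin.sum_univ_succ, comparison, Fin.cons_zero, Fin.cons_succ]
    rfl
  funext i
  simp only [Matrix.mulVec, dotProduct, mix, Pi.sub_apply, Pi.one_apply, Pi.add_apply, add_mul,
    Finset.sum_add_distrib, mul_assoc, ← Finset.mul_sum, hdot, mainRes, resFt, resKnown, errFt,
    errKnown, offset]
  ring

theorem sum_sub_comparison_sq_le_distBound (J : Fin n → Fin m) (x : CoordIdx n m D → ℝ)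
    (w : Fin (D + 2) → ℝ)
    (hw : (n : ℝ)⁻¹ * ∑ i, (θ.mix J x i ⬝ᵥ w - 1) ^ 2 + θ.lam * ∑ k, w k ^ 2 ≤
      (n : ℝ)⁻¹ * ∑ i, (θ.mix J x i ⬝ᵥ θ.comparison x - 1) ^ 2 +
        θ.lam * ∑ k, θ.comparison x k ^ 2) :
    ∑ k, (w k - θ.comparison x k) ^ 2 ≤ θ.distBound J x :=
  sum_sub_sq_le_of_ridge_le (θ.mix J x) 1 _ _ (by positivity) θ.lam_pos w (θ.comparison x)
    (θ.mix_mulVec_comparison_sub_one J x) hw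

end Deterministic

section DependsOn

theorem dependsOn_resFt (i : Fin n) :
    DependsOn (θ.resFt i : (CoordIdx n m D → ℝ) → ℝ) {p | p.1 = Sum.inl i} := by
  intro x y h
  simp only [resFt, h (Sum.inl i, 0) rfl, h (Sum.inl i, 1) rfl]

theorem resFt_eq_coreOf (i : Fin n) (x : CoordIdx n m D → ℝ) :
    θ.resFt i x = θ.resFt 0 (coreOf (fun _ : Fin 1 => i) (Fin.elim0 : Fin 0 → Fin m) x) := rfl

theorem resKnown_eq_coreOf (j : Fin m) (x : CoordIdx n m D → ℝ) :
    θ.resKnown j x = θ.resKnown 0 (coreOf (Fin.elim0 : Fin 0 → Fin n) (fun _ : Fin 1 => j) x) :=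
  rfl

theorem mainRes_eq_coreOf (J : Fin n → Fin m) (i : Fin n) (x : CoordIdx n m D → ℝ) :
    θ.mainRes J i x = θ.mainRes id 0 (coreOf (fun _ : Fin 1 => i) (fun _ : Fin 1 => J i) x) :=
  rfl

theorem gradTerm_eq_coreOf (J : Fin n → Fin m) (k : Fin 2) (i : Fin n) (x : CoordIdx n m D → ℝ) :
    θ.gradTerm J (Fin.castLE (Nat.le_add_left 2 D) k) i x =
      θ.gradTerm id k 0 (coreOf (fun _ : Fin 1 => i) (fun _ : Fin 1 => J i) x) := by
  fin_cases k <;> rfl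

theorem dependsOn_gradTerm (J : Fin n → Fin m) (k : Fin 2) (i : Fin n) :
    DependsOn (θ.gradTerm J (Fin.castLE (Nat.le_add_left 2 D) k) i : (CoordIdx n m D → ℝ) → ℝ)
      {p | p.1 = Sum.inl i ∨ p.1 = Sum.inr (J i)} := by
  intro x y h
  rw [gradTerm_eq_coreOf, gradTerm_eq_coreOf]
  congr 1
  funext p
  rcases p with ⟨_ | _, k⟩
  · exact h _ (Or.inl rfl)
  · exact h _ (Or.inr rfl)

end DependsOn

section Update

variable (e : Fin n ⊕ Fin m) (l : Fin D) (x : CoordIdx n m D → ℝ) (t : ℝ)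

@[simp]
theorem resFt_update (i : Fin n) :
    θ.resFt i (Function.update x (e, l.succ.succ) t) = θ.resFt i x := by
  simp [resFt, Prod.ext_iff, Fin.ext_iff]

@[simp]
theorem resKnown_update (j : Fin m) :
    θ.resKnown j (Function.update x (e, l.succ.succ) t) = θ.resKnown j x := by
  simp [resKnown, Prod.ext_iff, Fin.ext_iff]

@[simp]
theorem mainRes_update (J : Fin n → Fin m) (i : Fin n) :
    θ.mainRes J i (Function.update x (e, l.succ.succ) t) = θ.mainRes J i x := by
  simp [mainRes]

@[simp]
theorem noiseWeight_update_inl (i : Fin n) (l' : Fin D) :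
    θ.noiseWeight l' (Function.update x (Sum.inl i, l.succ.succ) t) = θ.noiseWeight l' x := by
  simp [noiseWeight]

end Update

end

end Params

/-- The moment conditions on the law of the noise coordinates: centred, variance `τ`, and a bound on
the fourth moment that is uniform under scaling. -/
structure NoiseMoments (κ : Measure ℝ) (τ K : ℝ) : Prop where
  mean : ∫ t, t ∂κ = 0
  var : ∫ t, t ^ 2 ∂κ = τ
  fourth : ∫ t, (t ^ 2 - τ) ^ 2 ∂κ ≤ K * τ ^ 2

namespace Params

noncomputable section

variable {n m D : ℕ} (θ : Params)

section HasMoments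

variable {μ : CoordIdx n m D → Measure ℝ} [∀ k, IsProbabilityMeasure (μ k)] [∀ k, AllMoments (μ k)]

@[fun_prop]
theorem hasMoments_resFt (i : Fin n) : HasMoments (θ.resFt i) (Measure.pi μ) := by
  unfold resFt; fun_prop

@[fun_prop]
theorem hasMoments_resKnown (j : Fin m) : HasMoments (θ.resKnown j) (Measure.pi μ) := by
  unfold resKnown; fun_prop

@[fun_prop]
theorem hasMoments_mainRes (J : Fin n → Fin m) (i : Fin n) :
    HasMoments (θ.mainRes J i) (Measure.pi μ) := by
  unfold mainRes; fun_prop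

@[fun_prop]
theorem hasMoments_noiseWeight (l : Fin D) : HasMoments (θ.noiseWeight l) (Measure.pi μ) := by
  unfold noiseWeight; fun_prop

@[fun_prop]
theorem hasMoments_errFt (i : Fin n) : HasMoments (θ.errFt i) (Measure.pi μ) := by
  unfold errFt; fun_prop

@[fun_prop]
theorem hasMoments_errKnown (j : Fin m) : HasMoments (θ.errKnown j) (Measure.pi μ) := by
  unfold errKnown; fun_prop

@[fun_prop]
theorem hasMoments_comparison (k : Fin (D + 2)) :
    HasMoments (θ.comparison · k) (Measure.pi μ) := by
  induction k using Fin.cases with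
  | zero => exact HasMoments.const θ.a
  | succ k =>
    induction k using Fin.cases with
    | zero => exact HasMoments.const θ.b
    | succ l => exact θ.hasMoments_noiseWeight l

@[fun_prop]
theorem hasMoments_gradTerm (J : Fin n → Fin m) (k : Fin (D + 2)) (i : Fin n) :
    HasMoments (θ.gradTerm J k i) (Measure.pi μ) := by
  unfold gradTerm mix; fun_prop

@[fun_prop]
theorem hasMoments_gradMain (J : Fin n → Fin m) (k : Fin (D + 2)) :
    HasMoments (θ.gradMain J k) (Measure.pi μ) := by
  unfold gradMain mix; fun_prop

@[fun_prop]
theorem hasMoments_distBound (J : Fin n → Fin m) : HasMoments (θ.distBound J) (Measure.pi μ) := by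
  unfold distBound; fun_prop

end HasMoments

variable (ν : Bool → Fin 2 → Measure ℝ)

/-- The second moment of `resFt`. -/
def sqFt : ℝ := ∫ x, θ.resFt 0 x ^ 2 ∂coreLaw ν 1 0

/-- The second moment of `resKnown`. -/
def sqKnown : ℝ := ∫ x, θ.resKnown 0 x ^ 2 ∂coreLaw ν 0 1

/-- The second moment of `mainRes`. -/
def sqMain : ℝ := ∫ x, θ.mainRes id 0 x ^ 2 ∂coreLaw ν 1 1

/-- The second moment of `gradTerm`, for a core coordinate. -/
def sqGrad (k : Fin 2) : ℝ := ∫ x, θ.gradTerm id k 0 x ^ 2 ∂coreLaw ν 1 1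

/-- The comparison vector solves the limiting problem: the fine-tuning part of the residual is
centred and the core coordinates of the gradient vanish in expectation. -/
structure IsStationary : Prop where
  integral_resFt : ∫ x, θ.resFt 0 x ∂coreLaw ν 1 0 = 0
  integral_gradTerm : ∀ k : Fin 2, ∫ x, θ.gradTerm id k 0 x ∂coreLaw ν 1 1 = 0

variable {ν} {κ : Measure ℝ} [∀ b k, IsProbabilityMeasure (ν b k)] [∀ b k, AllMoments (ν b k)]
  [IsProbabilityMeasure κ]

section Core

theorem integral_resFt_sq (i : Fin n) :
    ∫ x : CoordIdx n m D → ℝ, θ.resFt i x ^ 2 ∂sampleLaw ν κ = θ.sqFt ν := by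
  simp_rw [θ.resFt_eq_coreOf i]
  exact integral_comp_coreOf ν κ (φ := fun z => θ.resFt 0 z ^ 2)
    (Function.injective_of_subsingleton _) (Function.injective_of_subsingleton _)
    (HasMoments.integrable (by fun_prop))

theorem integral_resKnown_sq (j : Fin m) :
    ∫ x : CoordIdx n m D → ℝ, θ.resKnown j x ^ 2 ∂sampleLaw ν κ = θ.sqKnown ν := by
  simp_rw [θ.resKnown_eq_coreOf j]
  exact integral_comp_coreOf ν κ (φ := fun z => θ.resKnown 0 z ^ 2)
    (Function.injective_of_subsingleton _) (Function.injective_of_subsingleton _)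
    (HasMoments.integrable (by fun_prop))

theorem integral_mainRes_sq (J : Fin n → Fin m) (i : Fin n) :
    ∫ x : CoordIdx n m D → ℝ, θ.mainRes J i x ^ 2 ∂sampleLaw ν κ = θ.sqMain ν := by
  simp_rw [θ.mainRes_eq_coreOf J i]
  exact integral_comp_coreOf ν κ (φ := fun z => θ.mainRes id 0 z ^ 2)
    (Function.injective_of_subsingleton _) (Function.injective_of_subsingleton _)
    (HasMoments.integrable (by fun_prop))

theorem integral_gradTerm_sq (J : Fin n → Fin m) (k : Fin 2) (i : Fin n) :
    ∫ x : CoordIdx n m D → ℝ, θ.gradTerm J (Fin.castLE (Nat.le_add_left 2 D) k) i x ^ 2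
      ∂sampleLaw ν κ = θ.sqGrad ν k := by
  simp_rw [θ.gradTerm_eq_coreOf J k i]
  exact integral_comp_coreOf ν κ (φ := fun z => θ.gradTerm id k 0 z ^ 2)
    (Function.injective_of_subsingleton _) (Function.injective_of_subsingleton _)
    (HasMoments.integrable (by fun_prop))

variable {θ} (hθ : θ.IsStationary ν)
include hθ

theorem IsStationary.integral_gradTerm_castLE (J : Fin n → Fin m) (k : Fin 2) (i : Fin n) :
    ∫ x : CoordIdx n m D → ℝ, θ.gradTerm J (Fin.castLE (Nat.le_add_left 2 D) k) i x
      ∂sampleLaw ν κ = 0 := by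
  simp_rw [θ.gradTerm_eq_coreOf J k i]
  rw [integral_comp_coreOf ν κ (Function.injective_of_subsingleton _)
    (Function.injective_of_subsingleton _) (HasMoments.integrable (by fun_prop))]
  exact hθ.integral_gradTerm k

theorem IsStationary.integral_resFt_mul (i i' : Fin n) (h : i ≠ i') :
    ∫ x : CoordIdx n m D → ℝ, θ.resFt i x * θ.resFt i' x ∂sampleLaw ν κ = 0 := by
  have hmean : ∫ x : CoordIdx n m D → ℝ, θ.resFt i x ∂sampleLaw ν κ = 0 := by
    simp_rw [θ.resFt_eq_coreOf i]
    rw [integral_comp_coreOf ν κ (Function.injective_of_subsingleton _)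
      (Function.injective_of_subsingleton _) (HasMoments.integrable (by fun_prop))]
    exact hθ.integral_resFt
  rw [integral_mul_of_dependsOn _ _ (θ.dependsOn_resFt i) ((θ.dependsOn_resFt i').mono ?_), hmean,
    zero_mul]
  rintro p hp hp'
  exact h (Sum.inl_injective (hp'.symm.trans hp))

variable [AllMoments κ]

theorem IsStationary.integral_sum_resFt_sq (S : Finset (Fin n)) :
    ∫ x : CoordIdx n m D → ℝ, (∑ i ∈ S, θ.resFt i x) ^ 2 ∂sampleLaw ν κ =
      S.card * θ.sqFt ν := by
  rw [HasMoments.integral_sq_sum_of_orthogonal S (fun i => by fun_prop)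
    fun i _ j _ => hθ.integral_resFt_mul i j]
  simp only [integral_resFt_sq, Finset.sum_const, nsmul_eq_mul]

theorem IsStationary.integral_gradMain_castLE_sq_le (hn : 0 < n) (J : Fin n → Fin m) (k : Fin 2) :
    ∫ x : CoordIdx n m D → ℝ, θ.gradMain J (Fin.castLE (Nat.le_add_left 2 D) k) x ^ 2
      ∂sampleLaw ν κ ≤ θ.sqGrad ν k * ∑ j, freq J j ^ 2 := by
  set k' : Fin (D + 2) := Fin.castLE (Nat.le_add_left 2 D) k
  have hmean (x : CoordIdx n m D → ℝ) :
      θ.gradMain J k' x = (∑ i, θ.gradTerm J k' i x) / n := by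
    simp only [gradMain, gradTerm, Finset.sum_add_distrib, Finset.sum_const, Finset.card_univ,
      Fintype.card_fin, nsmul_eq_mul]
    field_simp
  have horth (i i' : Fin n) (h : J i ≠ J i') :
      ∫ x : CoordIdx n m D → ℝ, θ.gradTerm J k' i x * θ.gradTerm J k' i' x ∂sampleLaw ν κ = 0 := by
    rw [integral_mul_of_dependsOn _ _ (θ.dependsOn_gradTerm J k i)
      ((θ.dependsOn_gradTerm J k i').mono ?_), hθ.integral_gradTerm_castLE, zero_mul]
    rintro p (hp | hp) (hp' | hp') <;> grind
  simp_rw [hmean, freq, div_pow, ← Finset.sum_div]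
  rw [integral_div, ← mul_div_assoc]
  gcongr
  exact HasMoments.integral_sq_sum_le_of_fiberwise_orthogonal J (fun i => by fun_prop) horth
    fun i => (θ.integral_gradTerm_sq J k i).le

end Core

end

end Params

section NoiseSums

variable {n m D : ℕ} {ν : Bool → Fin 2 → Measure ℝ} {κ : Measure ℝ} {τ K : ℝ}
  [∀ b k, IsProbabilityMeasure (ν b k)] [∀ b k, AllMoments (ν b k)]
  [IsProbabilityMeasure κ] [AllMoments κ]

theorem NoiseMoments.integral_sq_sum_mul (hκ : NoiseMoments κ τ K) {β : Type*} (S : Finset β)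
    {e : β → (Fin n ⊕ Fin m) × Fin D} (he : Function.Injective e)
    {f : β → (CoordIdx n m D → ℝ) → ℝ} (hfm : ∀ i, HasMoments (f i) (sampleLaw ν κ))
    (hf : ∀ i ∈ S, ∀ j ∈ S, ∀ x t,
      f i (Function.update x ((e j).1, (e j).2.succ.succ) t) = f i x) :
    ∫ x, (∑ i ∈ S, x ((e i).1, (e i).2.succ.succ) * f i x) ^ 2 ∂sampleLaw ν κ =
      τ * ∑ i ∈ S, ∫ x, f i x ^ 2 ∂sampleLaw ν κ := by
  have := integral_sq_sum_eval_mul (fun k : CoordIdx n m D => coordLaw (ν k.1.isLeft) κ k.2) S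
    (e := fun i => ((e i).1, (e i).2.succ.succ))
    (fun i j hij => he (by simpa [Prod.ext_iff] using hij)) (φ := fun _ t => t)
    (fun _ => measurable_id) (fun i => by fun_prop) (fun _ => hκ.mean) hfm hf
  rw [this, Finset.mul_sum, ← hκ.var]
  rfl

variable (θ : Params)

namespace Params

theorem integral_noiseWeight_sq (hκ : NoiseMoments κ τ K) (l : Fin D) :
    ∫ x : CoordIdx n m D → ℝ, θ.noiseWeight l x ^ 2 ∂sampleLaw ν κ =
      (θ.γ / m) ^ 2 * (τ * (m * θ.sqKnown ν)) := by
  simp_rw [noiseWeight, mul_pow, neg_sq]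
  rw [integral_const_mul, hκ.integral_sq_sum_mul Finset.univ (e := fun j => (Sum.inr j, l))
    (fun i j hij => by simpa using hij) (fun i => by fun_prop) (fun i _ j _ x t => by simp)]
  simp [integral_resKnown_sq]

theorem integral_errFt_sq (hκ : NoiseMoments κ τ K) (hm : 0 < m) (hD : 0 < D)
    (hτ : D * τ = θ.r * m) (i : Fin n) :
    ∫ x : CoordIdx n m D → ℝ, θ.errFt i x ^ 2 ∂sampleLaw ν κ =
      ((1 - θ.s) * θ.γ * θ.r) ^ 2 * θ.sqKnown ν * (m / D) := by
  have hτ' : τ = θ.r * m / D := by rw [← hτ]; field_simp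
  simp_rw [errFt, mul_pow]
  rw [integral_const_mul, hκ.integral_sq_sum_mul Finset.univ (e := fun l => (Sum.inl i, l))
    (fun i j hij => by simpa using hij) (fun i => by fun_prop) (fun i _ j _ x t => by simp)]
  simp only [θ.integral_noiseWeight_sq hκ, Finset.sum_const, Finset.card_univ, Fintype.card_fin,
    nsmul_eq_mul]
  rw [hτ']
  field_simp

theorem errKnown_eq (hm : 0 < m) (hτ : D * τ = θ.r * m) (j : Fin m) (x : CoordIdx n m D → ℝ) :
    θ.errKnown j x = -(θ.s * θ.γ / m) *
      ((∑ l : Fin D, (x (Sum.inr j, l.succ.succ) ^ 2 - τ) * θ.resKnown j x) +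
        ∑ l : Fin D, x (Sum.inr j, l.succ.succ) *
          ∑ k ∈ Finset.univ.erase j, x (Sum.inr k, l.succ.succ) * θ.resKnown k x) := by
  have hsplit (l : Fin D) : x (Sum.inr j, l.succ.succ) * θ.noiseWeight l x =
      -(θ.γ / m) * (((x (Sum.inr j, l.succ.succ) ^ 2 - τ) * θ.resKnown j x +
        x (Sum.inr j, l.succ.succ) *
          ∑ k ∈ Finset.univ.erase j, x (Sum.inr k, l.succ.succ) * θ.resKnown k x) +
        τ * θ.resKnown j x) := by
    rw [noiseWeight, ← Finset.add_sum_erase _ _ (Finset.mem_univ j)]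
    ring
  have htrace : θ.s * (θ.γ / m) * (D * τ) = 1 - θ.q := by
    rw [hτ, θ.one_sub_q]
    field_simp
  rw [errKnown, ← Finset.sum_add_distrib]
  simp_rw [hsplit]
  rw [← Finset.mul_sum, Finset.sum_add_distrib]
  simp only [Finset.sum_const, Finset.card_univ, Fintype.card_fin, nsmul_eq_mul]
  linear_combination (-θ.resKnown j x) * htrace

theorem integral_sq_sum_sq_sub_mul_resKnown_le (hκ : NoiseMoments κ τ K) (j : Fin m) :
    ∫ x : CoordIdx n m D → ℝ, (∑ l : Fin D, (x (Sum.inr j, l.succ.succ) ^ 2 - τ) *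
      θ.resKnown j x) ^ 2 ∂sampleLaw ν κ ≤ K * (D * τ ^ 2 * θ.sqKnown ν) := by
  have hB : 0 ≤ θ.sqKnown ν := integral_nonneg fun _ => sq_nonneg _
  have hmean : ∫ t, (t ^ 2 - τ) ∂κ = 0 := by
    rw [integral_sub (AllMoments.hasMoments_id.pow 2).integrable (integrable_const _), hκ.var,
      integral_const, probReal_univ, one_smul, sub_self]
  rw [integral_sq_sum_eval_mul (fun k : CoordIdx n m D => coordLaw (ν k.1.isLeft) κ k.2) Finset.univ
    (e := fun l : Fin D => (Sum.inr j, l.succ.succ)) (fun i j hij => by simpa using hij)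
    (φ := fun _ t => t ^ 2 - τ) (fun _ => by fun_prop) (fun _ => by fun_prop) (fun _ => hmean)
    (fun _ => by fun_prop) (fun _ _ _ _ x t => by simp)]
  calc _ ≤ ∑ l : Fin D, K * τ ^ 2 * θ.sqKnown ν := Finset.sum_le_sum fun l _ => by
        rw [θ.integral_resKnown_sq]
        exact mul_le_mul_of_nonneg_right hκ.fourth hB
    _ = K * (D * τ ^ 2 * θ.sqKnown ν) := by
        simp only [Finset.sum_const, Finset.card_univ, Fintype.card_fin, nsmul_eq_mul]
        ring

theorem integral_sq_sum_mul_sum_erase_le (hκ : NoiseMoments κ τ K) (j : Fin m) :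
    ∫ x : CoordIdx n m D → ℝ, (∑ l : Fin D, x (Sum.inr j, l.succ.succ) *
      ∑ k ∈ Finset.univ.erase j, x (Sum.inr k, l.succ.succ) * θ.resKnown k x) ^ 2 ∂sampleLaw ν κ ≤
      m * (D * τ ^ 2 * θ.sqKnown ν) := by
  have hB : 0 ≤ θ.sqKnown ν := integral_nonneg fun _ => sq_nonneg _
  have hinner (l : Fin D) : ∫ x : CoordIdx n m D → ℝ, (∑ k ∈ Finset.univ.erase j,
      x (Sum.inr k, l.succ.succ) * θ.resKnown k x) ^ 2 ∂sampleLaw ν κ =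
      τ * ((m - 1 : ℕ) * θ.sqKnown ν) := by
    rw [hκ.integral_sq_sum_mul (Finset.univ.erase j) (e := fun k => (Sum.inr k, l))
      (fun i j hij => by simpa using hij) (fun i => by fun_prop) (fun i _ j _ x t => by simp)]
    simp [integral_resKnown_sq]
  rw [hκ.integral_sq_sum_mul Finset.univ (e := fun l => (Sum.inr j, l))
    (fun i j hij => by simpa using hij) (fun i => by fun_prop)]
  · simp only [hinner, Finset.sum_const, Finset.card_univ, Fintype.card_fin, nsmul_eq_mul]
    calc τ * (D * (τ * ((m - 1 : ℕ) * θ.sqKnown ν)))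
        = (m - 1 : ℕ) * (D * τ ^ 2 * θ.sqKnown ν) := by ring
      _ ≤ m * (D * τ ^ 2 * θ.sqKnown ν) := by gcongr; exact Nat.sub_le m 1
  · intro l _ l' _ x t
    refine Finset.sum_congr rfl fun k hk => ?_
    rw [Function.update_of_ne (by simp [Finset.ne_of_mem_erase hk]), resKnown_update]

theorem integral_errKnown_sq_le (hκ : NoiseMoments κ τ K) (hK : 0 ≤ K) (hm : 0 < m) (hD : 0 < D)
    (hτ : D * τ = θ.r * m) (j : Fin m) :
    ∫ x : CoordIdx n m D → ℝ, θ.errKnown j x ^ 2 ∂sampleLaw ν κ ≤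
      2 * (θ.s * θ.γ * θ.r) ^ 2 * (K + 1) * θ.sqKnown ν * (m / D) := by
  have hB : 0 ≤ θ.sqKnown ν := integral_nonneg fun _ => sq_nonneg _
  have hτ' : τ = θ.r * m / D := by rw [← hτ]; field_simp
  have hm1 : (1 : ℝ) ≤ m := by exact_mod_cast hm
  simp_rw [θ.errKnown_eq hm hτ, mul_pow (-(θ.s * θ.γ / m)), neg_sq]
  rw [integral_const_mul]
  calc _ ≤ (θ.s * θ.γ / m) ^ 2 * (2 * (K * (D * τ ^ 2 * θ.sqKnown ν)) +
        2 * (m * (D * τ ^ 2 * θ.sqKnown ν))) := by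
        gcongr
        refine (HasMoments.integral_sq_add_le (by fun_prop) (by fun_prop)).trans ?_
        gcongr
        · exact θ.integral_sq_sum_sq_sub_mul_resKnown_le hκ j
        · exact θ.integral_sq_sum_mul_sum_erase_le hκ j
    _ = 2 * (θ.s * θ.γ * θ.r) ^ 2 * (K / m + 1) * θ.sqKnown ν * (m / D) := by
        rw [hτ']
        field_simp
    _ ≤ 2 * (θ.s * θ.γ * θ.r) ^ 2 * (K + 1) * θ.sqKnown ν * (m / D) := by
        gcongr
        exact div_le_self hK hm1

end Params

end NoiseSums

noncomputable section GradMainNoise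

namespace Params

variable {n m D : ℕ} (θ : Params)

/-- The coefficient of the noise of the `j`-th known example in the noise coordinates of
`gradMain`. -/
def knownCoeff (J : Fin n → Fin m) (j : Fin m) (x : CoordIdx n m D → ℝ) : ℝ :=
  (∑ i with J i = j, θ.resFt i x) / n + θ.q * (freq J j - 1 / m) * θ.resKnown j x

theorem gradMain_succ_succ (J : Fin n → Fin m) (l : Fin D) (x : CoordIdx n m D → ℝ) :
    θ.gradMain J l.succ.succ x =
      (1 - θ.s) * (∑ i, x (Sum.inl i, l.succ.succ) * (θ.mainRes J i x / n)) +
        θ.s * ∑ j, x (Sum.inr j, l.succ.succ) * θ.knownCoeff J j x := by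
  have hfiber (j : Fin m) : x (Sum.inr j, l.succ.succ) * θ.knownCoeff J j x =
      (∑ i with J i = j, x (Sum.inr (J i), l.succ.succ) * θ.mainRes J i x) / n -
        θ.q / m * (x (Sum.inr j, l.succ.succ) * θ.resKnown j x) := by
    have : ∑ i with J i = j, x (Sum.inr (J i), l.succ.succ) * θ.mainRes J i x =
        ∑ i with J i = j, x (Sum.inr j, l.succ.succ) * (θ.resFt i x + θ.q * θ.resKnown j x) :=
      Finset.sum_congr rfl fun i hi => by rw [mainRes, (Finset.mem_filter.mp hi).2]
    rw [this, ← Finset.mul_sum, Finset.sum_add_distrib, knownCoeff, freq]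
    simp only [Finset.sum_const, nsmul_eq_mul]
    ring
  simp_rw [hfiber, ← mul_div_assoc]
  rw [Finset.sum_sub_distrib, ← Finset.sum_div, ← Finset.sum_div, Finset.sum_fiberwise,
    ← Finset.mul_sum, gradMain]
  simp only [mix, comparison, Fin.cons_succ, noiseWeight, add_mul, mul_assoc,
    Finset.sum_add_distrib, ← Finset.mul_sum]
  linear_combination
    (-(∑ j, x (Sum.inr j, l.succ.succ) * θ.resKnown j x) / m) * θ.lam_mul_γ

@[simp]
theorem knownCoeff_update (J : Fin n → Fin m) (j : Fin m) (e : Fin n ⊕ Fin m) (l : Fin D)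
    (x : CoordIdx n m D → ℝ) (t : ℝ) :
    θ.knownCoeff J j (Function.update x (e, l.succ.succ) t) = θ.knownCoeff J j x := by
  simp [knownCoeff]

@[fun_prop]
theorem hasMoments_knownCoeff {μ : CoordIdx n m D → Measure ℝ} [∀ k, IsProbabilityMeasure (μ k)]
    [∀ k, AllMoments (μ k)] (J : Fin n → Fin m) (j : Fin m) :
    HasMoments (θ.knownCoeff J j) (Measure.pi μ) := by
  unfold knownCoeff; fun_prop

variable {θ} {ν : Bool → Fin 2 → Measure ℝ} {κ : Measure ℝ} {τ K : ℝ}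
  [∀ b k, IsProbabilityMeasure (ν b k)] [∀ b k, AllMoments (ν b k)]
  [IsProbabilityMeasure κ] [AllMoments κ]

theorem IsStationary.sum_integral_knownCoeff_sq_le (hθ : θ.IsStationary ν) (J : Fin n → Fin m) :
    ∑ j, ∫ x : CoordIdx n m D → ℝ, θ.knownCoeff J j x ^ 2 ∂sampleLaw ν κ ≤
      2 * (θ.sqFt ν / n) + 2 * (θ.q ^ 2 * freqDev J * θ.sqKnown ν) := by
  have hj (j : Fin m) : ∫ x : CoordIdx n m D → ℝ, θ.knownCoeff J j x ^ 2 ∂sampleLaw ν κ ≤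
      2 * (({i | J i = j} : Finset (Fin n)).card * θ.sqFt ν / n ^ 2) +
        2 * (θ.q ^ 2 * (freq J j - 1 / m) ^ 2 * θ.sqKnown ν) := by
    refine (HasMoments.integral_sq_add_le (by fun_prop) (by fun_prop)).trans_eq ?_
    simp_rw [div_pow, mul_pow]
    rw [integral_div, integral_const_mul, hθ.integral_sum_resFt_sq, θ.integral_resKnown_sq]
  refine (Finset.sum_le_sum fun j _ => hj j).trans_eq ?_
  rw [Finset.sum_add_distrib, ← Finset.mul_sum, ← Finset.mul_sum, ← Finset.sum_div,
    ← Finset.sum_mul, ← Finset.sum_mul, ← Finset.mul_sum, sum_card_fiber, freqDev]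
  field_simp

theorem IsStationary.integral_gradMain_succ_succ_sq_le (hθ : θ.IsStationary ν)
    (hκ : NoiseMoments κ τ K) (hτ : 0 ≤ τ) (J : Fin n → Fin m) (l : Fin D) :
    ∫ x : CoordIdx n m D → ℝ, θ.gradMain J l.succ.succ x ^ 2 ∂sampleLaw ν κ ≤
      τ * (2 * (1 - θ.s) ^ 2 * (θ.sqMain ν / n) +
        2 * θ.s ^ 2 * (2 * (θ.sqFt ν / n) + 2 * (θ.q ^ 2 * freqDev J * θ.sqKnown ν))) := by
  simp_rw [θ.gradMain_succ_succ]
  refine (HasMoments.integral_sq_add_le (by fun_prop) (by fun_prop)).trans ?_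
  simp_rw [mul_pow]
  rw [integral_const_mul, integral_const_mul,
    hκ.integral_sq_sum_mul Finset.univ (e := fun i => (Sum.inl i, l))
      (fun i j hij => by simpa using hij) (fun i => by fun_prop) (fun i _ j _ x t => by simp),
    hκ.integral_sq_sum_mul Finset.univ (e := fun j => (Sum.inr j, l))
      (fun i j hij => by simpa using hij) (fun i => by fun_prop) (fun i _ j _ x t => by simp)]
  have hft : ∑ i, ∫ x : CoordIdx n m D → ℝ, (θ.mainRes J i x / n) ^ 2 ∂sampleLaw ν κ =
      θ.sqMain ν / n := by
    simp_rw [div_pow, integral_div, integral_mainRes_sq, Finset.sum_const, Finset.card_univ,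
      Fintype.card_fin, nsmul_eq_mul]
    field_simp
  rw [hft]
  calc _ = τ * (2 * (1 - θ.s) ^ 2 * (θ.sqMain ν / n) + 2 * θ.s ^ 2 *
        ∑ j, ∫ x : CoordIdx n m D → ℝ, θ.knownCoeff J j x ^ 2 ∂sampleLaw ν κ) := by ring
    _ ≤ _ := by
        gcongr
        exact hθ.sum_integral_knownCoeff_sq_le J

end Params

end GradMainNoise

section DistBound

namespace Params

variable {n m D : ℕ} {θ : Params} {ν : Bool → Fin 2 → Measure ℝ} {κ : Measure ℝ} {τ K : ℝ}
  [∀ b k, IsProbabilityMeasure (ν b k)] [∀ b k, AllMoments (ν b k)]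
  [IsProbabilityMeasure κ] [AllMoments κ]

theorem integral_errFt_add_errKnown_sq_le (hκ : NoiseMoments κ τ K) (hK : 0 ≤ K) (hm : 0 < m)
    (hD : 0 < D) (hτ : D * τ = θ.r * m) (i : Fin n) (j : Fin m) :
    ∫ x : CoordIdx n m D → ℝ, (θ.errFt i x + θ.errKnown j x) ^ 2 ∂sampleLaw ν κ ≤
      (2 * ((1 - θ.s) * θ.γ * θ.r) ^ 2 + 4 * (θ.s * θ.γ * θ.r) ^ 2 * (K + 1)) * θ.sqKnown ν *
        (m / D) := by
  refine (HasMoments.integral_sq_add_le (by fun_prop) (by fun_prop)).trans ?_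
  rw [θ.integral_errFt_sq hκ hm hD hτ]
  linarith [θ.integral_errKnown_sq_le (n := n) (ν := ν) hκ hK hm hD hτ j]

theorem IsStationary.sum_integral_gradMain_sq_le (hθ : θ.IsStationary ν)
    (hκ : NoiseMoments κ τ K) (hn : 0 < n) (hm : 0 < m) (hτ : D * τ = θ.r * m)
    (J : Fin n → Fin m) :
    ∑ k, ∫ x : CoordIdx n m D → ℝ, θ.gradMain J k x ^ 2 ∂sampleLaw ν κ ≤
      (θ.sqGrad ν 0 + θ.sqGrad ν 1) * (freqDev J + 1 / m) +
        θ.r * m * (2 * (1 - θ.s) ^ 2 * (θ.sqMain ν / n) +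
          2 * θ.s ^ 2 * (2 * (θ.sqFt ν / n) + 2 * (θ.q ^ 2 * freqDev J * θ.sqKnown ν))) := by
  have hτ0 : 0 ≤ τ := hκ.var ▸ integral_nonneg fun _ => sq_nonneg _
  have hcore (k : Fin 2) := hθ.integral_gradMain_castLE_sq_le (κ := κ) (D := D) hn J k
  simp only [sum_freq_sq hn hm] at hcore
  have hnoise := Finset.sum_le_sum fun l (_ : l ∈ (Finset.univ : Finset (Fin D))) =>
    hθ.integral_gradMain_succ_succ_sq_le hκ hτ0 J l
  rw [Finset.sum_const, Finset.card_univ, Fintype.card_fin, nsmul_eq_mul, ← mul_assoc, hτ] at hnoise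
  rw [Fin.sum_univ_succ, Fin.sum_univ_succ, add_mul, ← add_assoc]
  exact add_le_add (add_le_add (hcore 0) (hcore 1)) hnoise

theorem integral_distBound (J : Fin n → Fin m) :
    ∫ x : CoordIdx n m D → ℝ, θ.distBound J x ∂sampleLaw ν κ =
      2 / θ.lam * ((n : ℝ)⁻¹ * ∑ i, ∫ x : CoordIdx n m D → ℝ,
        (θ.errFt i x + θ.errKnown (J i) x) ^ 2 ∂sampleLaw ν κ) +
      4 / θ.lam ^ 2 * ∑ k, ∫ x : CoordIdx n m D → ℝ, θ.gradMain J k x ^ 2 ∂sampleLaw ν κ := by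
  simp only [distBound]
  rw [integral_add (HasMoments.integrable (by fun_prop)) (HasMoments.integrable (by fun_prop))]
  simp only [integral_const_mul]
  rw [HasMoments.integral_sum _ fun i => by fun_prop,
    HasMoments.integral_sum _ fun k => by fun_prop]

theorem IsStationary.integral_distBound_le (hθ : θ.IsStationary ν) (hκ : NoiseMoments κ τ K)
    (hK : 0 ≤ K) (hn : 0 < n) (hm : 0 < m) (hD : 0 < D) (hτ : D * τ = θ.r * m)
    (J : Fin n → Fin m) :
    ∫ x : CoordIdx n m D → ℝ, θ.distBound J x ∂sampleLaw ν κ ≤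
      2 / θ.lam * ((2 * ((1 - θ.s) * θ.γ * θ.r) ^ 2 + 4 * (θ.s * θ.γ * θ.r) ^ 2 * (K + 1)) *
        θ.sqKnown ν * (m / D)) +
      4 / θ.lam ^ 2 * ((θ.sqGrad ν 0 + θ.sqGrad ν 1) * (freqDev J + 1 / m) +
        θ.r * (2 * (1 - θ.s) ^ 2 * θ.sqMain ν + 4 * θ.s ^ 2 * θ.sqFt ν) * (m / n) +
        θ.r * (4 * θ.s ^ 2 * θ.q ^ 2 * θ.sqKnown ν) * (m * freqDev J)) := by
  have := θ.lam_pos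
  set E := (2 * ((1 - θ.s) * θ.γ * θ.r) ^ 2 + 4 * (θ.s * θ.γ * θ.r) ^ 2 * (K + 1)) * θ.sqKnown ν
  calc _ ≤ 2 / θ.lam * ((n : ℝ)⁻¹ * ∑ _i : Fin n, E * (m / D)) + 4 / θ.lam ^ 2 *
        ((θ.sqGrad ν 0 + θ.sqGrad ν 1) * (freqDev J + 1 / m) +
          θ.r * m * (2 * (1 - θ.s) ^ 2 * (θ.sqMain ν / n) +
          2 * θ.s ^ 2 * (2 * (θ.sqFt ν / n) + 2 * (θ.q ^ 2 * freqDev J * θ.sqKnown ν)))) := by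
        rw [integral_distBound]
        gcongr with i
        · exact integral_errFt_add_errKnown_sq_le hκ hK hm hD hτ i (J i)
        · exact hθ.sum_integral_gradMain_sq_le hκ hn hm hτ J
    _ = _ := by
        rw [Finset.sum_const, Finset.card_univ, Fintype.card_fin, nsmul_eq_mul]
        field_simp
        ring

theorem IsStationary.exists_integral_distBound_le (hθ : θ.IsStationary ν) (hK : 0 ≤ K) :
    ∃ C, 0 ≤ C ∧ ∀ {n m D : ℕ}, 0 < n → 0 < m → 0 < D → ∀ {κ : Measure ℝ} {τ : ℝ}
      [IsProbabilityMeasure κ] [AllMoments κ], NoiseMoments κ τ K → D * τ = θ.r * m →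
      ∀ J : Fin n → Fin m, ∫ x : CoordIdx n m D → ℝ, θ.distBound J x ∂sampleLaw ν κ ≤
        C * (m / D + m / n + m * freqDev J + 1 / m) := by
  have := θ.lam_pos
  have := θ.r_nonneg
  have : 0 ≤ θ.sqKnown ν := integral_nonneg fun _ => sq_nonneg _
  have : 0 ≤ θ.sqFt ν := integral_nonneg fun _ => sq_nonneg _
  have : 0 ≤ θ.sqMain ν := integral_nonneg fun _ => sq_nonneg _
  have hgrad (k : Fin 2) : 0 ≤ θ.sqGrad ν k := integral_nonneg fun _ => sq_nonneg _
  set E := (2 * ((1 - θ.s) * θ.γ * θ.r) ^ 2 + 4 * (θ.s * θ.γ * θ.r) ^ 2 * (K + 1)) * θ.sqKnown ν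
  set G := θ.sqGrad ν 0 + θ.sqGrad ν 1
  set F := θ.r * (2 * (1 - θ.s) ^ 2 * θ.sqMain ν + 4 * θ.s ^ 2 * θ.sqFt ν)
  set B := θ.r * (4 * θ.s ^ 2 * θ.q ^ 2 * θ.sqKnown ν)
  have : 0 ≤ E := by positivity
  have : 0 ≤ G := add_nonneg (hgrad 0) (hgrad 1)
  have : 0 ≤ F := by positivity
  have : 0 ≤ B := by positivity
  refine ⟨2 / θ.lam * E + 4 / θ.lam ^ 2 * (G + F + B), by positivity,
    fun {n m D} hn hm hD {κ τ} _ _ hκ hτ J => ?_⟩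
  have hJ := freqDev_nonneg J
  have hmJ : freqDev J ≤ m * freqDev J := le_mul_of_one_le_left hJ (by exact_mod_cast hm)
  set R := (m / D + m / n + m * freqDev J + 1 / m : ℝ)
  calc _ ≤ 2 / θ.lam * (E * (m / D)) + 4 / θ.lam ^ 2 *
        (G * (freqDev J + 1 / m) + F * (m / n) + B * (m * freqDev J)) :=
        hθ.integral_distBound_le hκ hK hn hm hD hτ J
    _ ≤ 2 / θ.lam * (E * R) + 4 / θ.lam ^ 2 * (G * R + F * R + B * R) := by
        have : (0 : ℝ) ≤ m / D := by positivity
        have : (0 : ℝ) ≤ m / n := by positivity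
        have : (0 : ℝ) ≤ 1 / m := by positivity
        gcongr <;> linarith
    _ = _ := by ring

end Params

end DistBound

noncomputable section Stationary

/-- The means of the core coordinates of the fine-tuning (`b = true`) and known (`b = false`)
examples, once multiplied by their labels. -/
def coreMean (ρ : ℝ) (b : Bool) : Fin 2 → ℝ := ![1, if b then ρ else 0]

/-- The variances of the core coordinates of the fine-tuning (`b = true`) and known (`b = false`)
examples. -/
def coreVar (ρ v : ℝ) (b : Bool) : Fin 2 → ℝ := ![v, if b then 1 - ρ ^ 2 else 1]

/-- The moment conditions on the laws of the core coordinates. -/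
structure CoreMoments (ν : Bool → Fin 2 → Measure ℝ) (ρ v : ℝ) : Prop where
  mean b k : ∫ t, (t - coreMean ρ b k) ∂ν b k = 0
  var b k : ∫ t, (t - coreMean ρ b k) ^ 2 ∂ν b k = coreVar ρ v b k

namespace Params

variable {θ : Params} {ν : Bool → Fin 2 → Measure ℝ} [∀ b k, IsProbabilityMeasure (ν b k)]
  [∀ b k, AllMoments (ν b k)] {v : ℝ}

theorem gradTerm_id_eq_affine_mul_affine (k : Fin 2) (x : CoordIdx 1 1 0 → ℝ) :
    θ.gradTerm id k 0 x =
      ((1 - θ.s) * coreMean θ.ρ true k + θ.s * coreMean θ.ρ false k +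
        ∑ p : CoordIdx 1 1 0, (if p.2 = k then Sum.elim (fun _ => 1 - θ.s) (fun _ => θ.s) p.1
          else 0) * (x p - coreMean θ.ρ p.1.isLeft p.2)) *
      (θ.q * θ.offset + ∑ p : CoordIdx 1 1 0,
        Sum.elim (fun _ => 1 - θ.s) (fun _ => θ.q * θ.s) p.1 * ![θ.a, θ.b] p.2 *
          (x p - coreMean θ.ρ p.1.isLeft p.2)) + θ.lam * ![θ.a, θ.b] k := by
  have hc : θ.comparison x k = ![θ.a, θ.b] k := by fin_cases k <;> rfl
  rw [gradTerm, hc]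
  fin_cases k <;> simp [Fintype.sum_prod_type, mix, mainRes, resFt, resKnown, coreMean] <;> ring

theorem isStationary_of_normal_equations (hν : CoreMoments ν θ.ρ v)
    (hfst : θ.q * θ.offset + (1 - θ.s) ^ 2 * θ.a * v + θ.s ^ 2 * θ.q * θ.a * v +
      θ.lam * θ.a = 0)
    (hsnd : (1 - θ.s) * θ.ρ * (θ.q * θ.offset) + (1 - θ.s) ^ 2 * θ.b * (1 - θ.ρ ^ 2) +
      θ.s ^ 2 * θ.q * θ.b + θ.lam * θ.b = 0) :
    θ.IsStationary ν where
  integral_resFt := by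
    have h := integral_affine_mul_affine_pi (fun p : CoordIdx 1 0 0 => ν p.1.isLeft p.2)
      (fun p => hν.mean p.1.isLeft p.2) (fun p => hν.var p.1.isLeft p.2) 0 1
      (fun p => (1 - θ.s) * ![θ.a, θ.b] p.2) 0
    simpa [Fintype.sum_prod_type, coreMean, resFt, mul_add, mul_assoc] using h
  integral_gradTerm k := by
    have h := integral_affine_mul_affine_pi (fun p : CoordIdx 1 1 0 => ν p.1.isLeft p.2)
      (fun p => hν.mean p.1.isLeft p.2) (fun p => hν.var p.1.isLeft p.2)
      ((1 - θ.s) * coreMean θ.ρ true k + θ.s * coreMean θ.ρ false k) (θ.q * θ.offset)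
      (fun p => if p.2 = k then Sum.elim (fun _ => 1 - θ.s) (fun _ => θ.s) p.1 else 0)
      (fun p => Sum.elim (fun _ => 1 - θ.s) (fun _ => θ.q * θ.s) p.1 * ![θ.a, θ.b] p.2)
    simp_rw [gradTerm_id_eq_affine_mul_affine]
    rw [integral_add (HasMoments.integrable (by fun_prop)) (integrable_const _), h,
      integral_const, probReal_univ, one_smul]
    fin_cases k <;> simp only [Fintype.sum_prod_type, Fintype.sum_sum_type, Finset.univ_unique,
      Finset.sum_singleton, Fin.zero_eta, Fin.mk_one, Sum.elim_inl, Sum.elim_inr, ite_mul, zero_mul,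
      Finset.sum_ite_eq', Finset.mem_univ, Sum.isLeft_inl, Sum.isLeft_inr, coreMean, coreVar,
      Matrix.cons_val_zero, Matrix.cons_val_one, Matrix.cons_val_fin_one, if_true, if_false,
      Bool.false_eq_true]
    · linear_combination hfst
    · linear_combination hsnd

end Params

end Stationary

noncomputable section LimitParams

/-- The determinant of the limiting normal equations. -/
def limitDet (s p r lam σ₁ : ℝ) : ℝ := ψ₁ s r lam σ₁ * ψ₃ s p r lam - ψ₂ s p r lam ^ 2

variable {s p r lam σ₁ : ℝ}

theorem ψ₁_eq : ψ₁ s r lam σ₁ =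
    (1 - s) ^ 2 * σ₁ ^ 2 + q s r lam * (1 + s ^ 2 * σ₁ ^ 2) + lam := by
  rw [ψ₁]; ring

theorem ψ₂_eq : ψ₂ s p r lam = q s r lam * ((1 - s) * (2 * p - 1)) := by
  rw [ψ₂]; ring

theorem ψ₃_eq : ψ₃ s p r lam = (1 - s) ^ 2 * (1 - (2 * p - 1) ^ 2) +
    q s r lam * (((1 - s) * (2 * p - 1)) ^ 2 + s ^ 2) + lam := by
  rw [ψ₃]; ring

theorem limitDet_pos (hp : p ∈ Set.Icc (0 : ℝ) 1) (hr : 0 ≤ r) (hlam : 0 < lam) :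
    0 < limitDet s p r lam σ₁ := by
  have hq : 0 ≤ q s r lam := by rw [q]; positivity
  have hvar : 0 ≤ 1 - (2 * p - 1) ^ 2 := by nlinarith [hp.1, hp.2]
  set c := (1 - s) * (2 * p - 1)
  have h₁ : q s r lam + lam ≤ ψ₁ s r lam σ₁ := by
    rw [ψ₁_eq]
    have : 0 ≤ (1 - s) ^ 2 * σ₁ ^ 2 + q s r lam * (s ^ 2 * σ₁ ^ 2) := by positivity
    linarith
  have h₃ : q s r lam * c ^ 2 + lam ≤ ψ₃ s p r lam := by
    rw [ψ₃_eq]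
    have : 0 ≤ (1 - s) ^ 2 * (1 - (2 * p - 1) ^ 2) + q s r lam * s ^ 2 := by positivity
    linarith
  calc 0 < q s r lam * lam + lam * (q s r lam * c ^ 2) + lam * lam := by positivity
    _ = (q s r lam + lam) * (q s r lam * c ^ 2 + lam) - (q s r lam * c) ^ 2 := by ring
    _ ≤ limitDet s p r lam σ₁ := by
        rw [limitDet, ψ₂_eq]
        have : 0 ≤ ψ₁ s r lam σ₁ := le_trans (by positivity) h₁
        gcongr

variable (s p σ₁) in
/-- The parameters for which the comparison vector solves the limiting normal equations. -/
def limitParams (hr : 0 ≤ r) (hlam : 0 < lam) : Params where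
  s := s
  r := r
  lam := lam
  ρ := 2 * p - 1
  a := q s r lam / limitDet s p r lam σ₁ *
    (ψ₃ s p r lam - ψ₂ s p r lam * (1 - s) * (2 * p - 1))
  b := q s r lam / limitDet s p r lam σ₁ *
    (ψ₁ s r lam σ₁ * (1 - s) * (2 * p - 1) - ψ₂ s p r lam)
  r_nonneg := hr
  lam_pos := hlam

theorem limitLoss_eq (hr : 0 ≤ r) (hlam : 0 < lam) :
    limitLoss s p r lam σ₁ =
      ((limitParams s p σ₁ hr hlam).a - (limitParams s p σ₁ hr hlam).b - 1) ^ 2 +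
        σ₁ ^ 2 * (limitParams s p σ₁ hr hlam).a ^ 2 := by
  simp only [limitLoss, limitParams, limitDet]
  ring

theorem isStationary_limitParams {ν : Bool → Fin 2 → Measure ℝ}
    [∀ b k, IsProbabilityMeasure (ν b k)] [∀ b k, AllMoments (ν b k)]
    (hp : p ∈ Set.Icc (0 : ℝ) 1) (hr : 0 ≤ r) (hlam : 0 < lam)
    (hν : CoreMoments ν (2 * p - 1) (σ₁ ^ 2)) : (limitParams s p σ₁ hr hlam).IsStationary ν := by
  have hdet : limitDet s p r lam σ₁ ≠ 0 := (limitDet_pos hp hr hlam).ne'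
  set θ := limitParams s p σ₁ hr hlam with hθ
  have hfst : ψ₁ s r lam σ₁ * θ.a + ψ₂ s p r lam * θ.b = q s r lam := by
    simp only [hθ, limitParams]
    field_simp
    rw [limitDet]
    ring
  have hsnd : ψ₂ s p r lam * θ.a + ψ₃ s p r lam * θ.b = q s r lam * ((1 - s) * (2 * p - 1)) := by
    simp only [hθ, limitParams]
    field_simp
    rw [limitDet]
    ring
  rw [ψ₁_eq, ψ₂_eq] at hfst
  rw [ψ₂_eq, ψ₃_eq] at hsnd
  refine Params.isStationary_of_normal_equations hν ?_ ?_
  · change q s r lam * (θ.a + (1 - s) * (2 * p - 1) * θ.b - 1) + (1 - s) ^ 2 * θ.a * σ₁ ^ 2 +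
      s ^ 2 * q s r lam * θ.a * σ₁ ^ 2 + lam * θ.a = 0
    linear_combination hfst
  · change (1 - s) * (2 * p - 1) * (q s r lam * (θ.a + (1 - s) * (2 * p - 1) * θ.b - 1)) +
      (1 - s) ^ 2 * θ.b * (1 - (2 * p - 1) ^ 2) + s ^ 2 * q s r lam * θ.b + lam * θ.b = 0
    linear_combination hsnd

end LimitParams

section SignedInputs

open unitInterval (toNNReal symm)

theorem sgn_mul_self (b : Bool) : sgn b * sgn b = 1 := by cases b <;> simp [sgn]

@[fun_prop]
theorem measurable_sgn : Measurable sgn := measurable_of_countable _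

/-- The probability `1 / 2`, as a parameter of a Bernoulli law. -/
noncomputable def half : unitInterval := ⟨1 / 2, by norm_num, by norm_num⟩

/-- The uniform law on the labels. -/
noncomputable abbrev labelLaw : Measure Bool := Ber(true, false, half)

/-- The laws of the core coordinates of an input multiplied by its label, when the second one has
law `ν`. -/
noncomputable def signedCoreLaw (σ₁ : ℝ≥0) (ν : Measure ℝ) : Fin 2 → Measure ℝ :=
  ![gaussianReal 1 (σ₁ ^ 2), ν]

instance (σ₁ : ℝ≥0) (ν : Measure ℝ) [IsProbabilityMeasure ν] (k : Fin 2) :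
    IsProbabilityMeasure (signedCoreLaw σ₁ ν k) := by
  fin_cases k
  · exact inferInstanceAs (IsProbabilityMeasure (gaussianReal _ _))
  · exact inferInstanceAs (IsProbabilityMeasure ν)

/-- The law of an input multiplied by its label, when the second coordinate of the product has law
`ν`. -/
noncomputable def signedInputLaw (D : ℕ) (σ₁ τ : ℝ≥0) (ν : Measure ℝ) : Measure (Fin (D + 2) → ℝ) :=
  Measure.pi (coordLaw (signedCoreLaw σ₁ ν) (gaussianReal 0 τ))

instance (D : ℕ) (σ₁ τ : ℝ≥0) (ν : Measure ℝ) [IsProbabilityMeasure ν] :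
    IsProbabilityMeasure (signedInputLaw D σ₁ τ ν) := by
  unfold signedInputLaw; infer_instance

theorem signedInputLaw_bernoulliMeasure (D : ℕ) (σ₁ τ : ℝ≥0) (x y : ℝ) (p : unitInterval) :
    signedInputLaw D σ₁ τ Ber(x, y, p) =
      toNNReal p • signedInputLaw D σ₁ τ (Measure.dirac x) +
        toNNReal (symm p) • signedInputLaw D σ₁ τ (Measure.dirac y) := by
  refine Measure.pi_eq fun s _ => ?_
  simp only [signedInputLaw, Measure.add_apply, Measure.smul_apply, Measure.pi_pi]
  simp only [Fin.prod_univ_succ, coordLaw, signedCoreLaw, bernoulliMeasure_def, Measure.add_apply,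
    Measure.smul_apply, ENNReal.smul_def, smul_eq_mul, Fin.cons_zero, Fin.cons_succ,
    Matrix.cons_val_zero, Matrix.cons_val_one]
  ring

theorem inputLaw_map_smul (D : ℕ) (σ₁ σξ : ℝ≥0) (y a : Bool) :
    (inputLaw (D + 2) σ₁ 0 σξ y a).map (fun x => sgn y • x) =
      signedInputLaw D σ₁ (σξ ^ 2 / D) (Measure.dirac (sgn y * sgn a)) := by
  have hsmul : (fun x : Fin (D + 2) → ℝ => sgn y • x) = fun x i => sgn y * x i := rfl
  rw [inputLaw, hsmul, Measure.pi_map_pi (fun i => by fun_prop), signedInputLaw]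
  congr 1
  ext1 l
  have hsgn : NNReal.mk (sgn y ^ 2) (sq_nonneg _) = 1 := by ext; simp [sq, sgn_mul_self]
  rw [gaussianReal_map_const_mul, hsgn, one_mul]
  induction l using Fin.cases with
  | zero => simp [coordMean, coordVar, coordLaw, signedCoreLaw, sgn_mul_self]
  | succ l =>
    induction l using Fin.cases with
    | zero => simp [coordMean, coordVar, coordLaw, signedCoreLaw]
    | succ l => simp [coordMean, coordVar, coordLaw]

/-- The label of an example and its input multiplied by the label. -/
def signedExample {d : ℕ} (e : Example d) : Bool × (Fin d → ℝ) := (e.label, sgn e.label • e.input)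

theorem measurable_signedExample {d : ℕ} : Measurable (signedExample : Example d → _) := by
  unfold signedExample Example.label Example.input
  fun_prop

instance (d : ℕ) (σ₁ σ₂ σξ : ℝ≥0) (y a : Bool) :
    IsProbabilityMeasure (inputLaw d σ₁ σ₂ σξ y a) := by
  unfold inputLaw; infer_instance

theorem map_signedExample_inputLaw_prod_dirac (D : ℕ) (σ₁ σξ : ℝ≥0) (y a : Bool) :
    ((inputLaw (D + 2) σ₁ 0 σξ y a).prod (Measure.dirac (y, a))).map signedExample =
      (Measure.dirac y).prod
        (signedInputLaw D σ₁ (σξ ^ 2 / D) (Measure.dirac (sgn y * sgn a))) := by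
  rw [Measure.prod_dirac, Measure.map_map measurable_signedExample (by fun_prop),
    ← inputLaw_map_smul, Measure.dirac_prod, Measure.map_map (by fun_prop) (by fun_prop)]
  rfl

theorem ofReal_half_mul (p : unitInterval) :
    ENNReal.ofReal (1 / 2 * p) = (toNNReal half * toNNReal p : ℝ≥0) :=
  ENNReal.ofReal_eq_coe_nnreal (mul_nonneg half.2.1 p.2.1)

theorem measurePreserving_signedExample (D : ℕ) (σ₁ σξ : ℝ≥0) (p : unitInterval) :
    MeasurePreserving signedExample (dataLaw (D + 2) σ₁ 0 σξ p)
      (labelLaw.prod (signedInputLaw D σ₁ (σξ ^ 2 / D) Ber(1, -1, p))) := by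
  have hsymm : symm half = half := by ext; norm_num [half]
  have hp : ENNReal.ofReal (1 / 2 * p) = toNNReal half * toNNReal p := by
    rw [ofReal_half_mul]; rfl
  have hp' : ENNReal.ofReal (1 / 2 * (1 - p)) = toNNReal half * toNNReal (symm p) :=
    (ofReal_half_mul (symm p)).trans rfl
  refine ⟨measurable_signedExample, ?_⟩
  simp only [dataLaw, Fintype.sum_bool, Measure.map_add _ _ measurable_signedExample,
    Measure.map_smul, map_signedExample_inputLaw_prod_dirac, if_true, reduceCtorEq, if_false,
    signedInputLaw_bernoulliMeasure, bernoulliMeasure_def true, hsymm, ENNReal.smul_def, hp, hp',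
    Measure.prod_smul_left, Measure.add_prod, Measure.prod_add, Measure.prod_smul_right, sgn]
  simp only [mul_one, mul_neg, neg_neg, smul_add, smul_smul,
    mul_comm (toNNReal half : ℝ≥0∞)]
  abel

instance isProbabilityMeasure_dataLaw (D : ℕ) (σ₁ σξ : ℝ≥0) (p : unitInterval) :
    IsProbabilityMeasure (dataLaw (D + 2) σ₁ 0 σξ p) := by
  have := (measurePreserving_signedExample D σ₁ σξ p).map_eq
  have : IsProbabilityMeasure ((dataLaw (D + 2) σ₁ 0 σξ p).map signedExample) := by
    rw [this]; infer_instance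
  exact Measure.isProbabilityMeasure_of_map signedExample

/-- The inputs multiplied by their labels. -/
def signedInputs {n m D : ℕ} (S : DataSets n (D + 2) m) (k : CoordIdx n m D) : ℝ :=
  (Sum.elim (fun i => sgn (S.1 i).label • (S.1 i).input)
    (fun j => sgn (S.2 j).label • (S.2 j).input) k.1 : Fin (D + 2) → ℝ) k.2

/-- The laws of the core coordinates of the inputs multiplied by their labels. -/
noncomputable def signedCoreLaws (σ₁ : ℝ≥0) (p : unitInterval) (b : Bool) : Fin 2 → Measure ℝ :=
  signedCoreLaw σ₁ Ber(1, -1, if b then p else half)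

instance (σ₁ : ℝ≥0) (p : unitInterval) (b : Bool) (k : Fin 2) :
    IsProbabilityMeasure (signedCoreLaws σ₁ p b k) := by
  unfold signedCoreLaws; infer_instance

theorem measurePreserving_uncurry {ι κ : Type*} [Fintype ι] [Fintype κ]
    (μ : ι → κ → Measure ℝ) [∀ i j, IsProbabilityMeasure (μ i j)] :
    MeasurePreserving (fun (z : ι → κ → ℝ) (p : ι × κ) => z p.1 p.2)
      (Measure.pi fun i => Measure.pi (μ i)) (Measure.pi fun p => μ p.1 p.2) := by
  refine ⟨by fun_prop, ?_⟩
  have h := Measure.infinitePi_map_curry_symm μ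
  simp_rw [Measure.infinitePi_eq_pi] at h
  exact h

/-- The law of the two data sets. -/
noncomputable abbrev dataSetsLaw (n m D : ℕ) (σ₁ σξ : ℝ≥0) (p : unitInterval) :
    Measure (DataSets n (D + 2) m) :=
  (Measure.pi fun _ => dataLaw (D + 2) σ₁ 0 σξ p).prod
    (Measure.pi fun _ => dataLaw (D + 2) σ₁ 0 σξ half)

/-- The law of the labels in the two data sets. -/
noncomputable abbrev labelsLaw (n m : ℕ) : Measure ((Fin n → Bool) × (Fin m → Bool)) :=
  (Measure.pi fun _ => labelLaw).prod (Measure.pi fun _ => labelLaw)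

theorem measurePreserving_labels_signedInputs (n m D : ℕ) (σ₁ σξ : ℝ≥0) (p : unitInterval) :
    MeasurePreserving (fun S => (labels S, signedInputs S)) (dataSetsLaw n m D σ₁ σξ p)
      ((labelsLaw n m).prod
        (sampleLaw (signedCoreLaws σ₁ p) (gaussianReal 0 (σξ ^ 2 / D)))) := by
  let pr (b : Fin n ⊕ Fin m) : unitInterval := if b.isLeft then p else half
  have (b : Fin n ⊕ Fin m) : SigmaFinite (dataLaw (D + 2) σ₁ 0 σξ (pr b)) :=
    have := isProbabilityMeasure_dataLaw D σ₁ σξ (pr b)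
    inferInstance
  have hsum := measurePreserving_sumPiEquivProdPi_symm fun b => dataLaw (D + 2) σ₁ 0 σξ (pr b)
  have hsigned := measurePreserving_pi _ _ fun b => measurePreserving_signedExample D σ₁ σξ (pr b)
  have hsplit := measurePreserving_arrowProdEquivProdArrow Bool (Fin (D + 2) → ℝ) (Fin n ⊕ Fin m)
    (fun _ => labelLaw) (fun b => signedInputLaw D σ₁ (σξ ^ 2 / D) Ber(1, -1, pr b))
  have hcurry := (measurePreserving_sumPiEquivProdPi fun _ : Fin n ⊕ Fin m => labelLaw).prod
    (measurePreserving_uncurry fun b =>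
      coordLaw (D := D) (signedCoreLaw σ₁ Ber(1, -1, pr b)) (gaussianReal 0 (σξ ^ 2 / D)))
  convert hcurry.comp (hsplit.comp (hsigned.comp hsum)) using 1
  · ext S : 1
    refine Prod.ext rfl ?_
    ext ⟨b, l⟩
    rcases b with i | j <;> rfl
  · rfl
  · rfl

end SignedInputs

section LawMoments

instance (μ : ℝ) (v : ℝ≥0) : AllMoments (gaussianReal μ v) :=
  ⟨fun p hp => memLp_id_gaussianReal' p hp⟩

instance (x y : ℝ) (p : unitInterval) : AllMoments Ber(x, y, p) := by
  refine ⟨fun q _ => MemLp.of_bound (by fun_prop) (max |x| |y|) ?_⟩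
  rw [bernoulliMeasure_def, ae_add_measure_iff]
  constructor <;> refine Measure.ae_smul_measure ?_ _ <;> simp [ae_dirac_eq]

instance (σ₁ : ℝ≥0) (ν : Measure ℝ) [AllMoments ν] (k : Fin 2) :
    AllMoments (signedCoreLaw σ₁ ν k) := by
  fin_cases k
  · exact inferInstanceAs (AllMoments (gaussianReal _ _))
  · exact inferInstanceAs (AllMoments ν)

instance (σ₁ : ℝ≥0) (p : unitInterval) (b : Bool) (k : Fin 2) :
    AllMoments (signedCoreLaws σ₁ p b k) := by
  unfold signedCoreLaws; infer_instance

theorem integral_sub_mean_gaussianReal (μ : ℝ) (v : ℝ≥0) :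
    ∫ t, (t - μ) ∂gaussianReal μ v = 0 := by
  rw [integral_sub AllMoments.hasMoments_id.integrable (integrable_const _),
    integral_id_gaussianReal]
  simp

theorem integral_sub_mean_sq_gaussianReal (μ : ℝ) (v : ℝ≥0) :
    ∫ t, (t - μ) ^ 2 ∂gaussianReal μ v = v := by
  have h := variance_fun_id_gaussianReal (μ := μ) (v := v)
  rwa [variance_eq_integral (by fun_prop), integral_id_gaussianReal] at h

theorem integral_sq_sub_sq_gaussianReal (v : ℝ≥0) :
    ∫ t, (t ^ 2 - (v : ℝ)) ^ 2 ∂gaussianReal 0 v =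
      (∫ t, (t ^ 2 - 1) ^ 2 ∂gaussianReal 0 1) * (v : ℝ) ^ 2 := by
  have h : gaussianReal 0 v = (gaussianReal 0 1).map (Real.sqrt v * ·) := by
    rw [gaussianReal_map_const_mul, mul_zero, mul_one]
    congr 1
    ext
    simp
  rw [h, integral_map (by fun_prop) (by fun_prop), ← integral_mul_const]
  congr 1
  ext t
  rw [mul_pow, Real.sq_sqrt (NNReal.coe_nonneg v)]
  ring

theorem noiseMoments_gaussianReal (v : ℝ≥0) :
    NoiseMoments (gaussianReal 0 v) v (∫ t, (t ^ 2 - 1) ^ 2 ∂gaussianReal 0 1) where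
  mean := integral_id_gaussianReal
  var := by simpa only [sub_zero] using integral_sub_mean_sq_gaussianReal 0 v
  fourth := (integral_sq_sub_sq_gaussianReal v).le

theorem coreMoments_signedCoreLaws (σ₁ : ℝ≥0) (p : unitInterval) :
    CoreMoments (signedCoreLaws σ₁ p) (2 * p - 1) (σ₁ ^ 2) where
  mean b k := by
    fin_cases k
    · exact integral_sub_mean_gaussianReal 1 _
    · cases b <;>
        norm_num [signedCoreLaws, signedCoreLaw, coreMean, integral_bernoulliMeasure, half]
      ring
  var b k := by
    fin_cases k
    · exact (integral_sub_mean_sq_gaussianReal 1 _).trans (by simp [coreVar])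
    · cases b <;> norm_num [signedCoreLaws, signedCoreLaw, coreMean, coreVar,
        integral_bernoulliMeasure, half]
      ring

end LawMoments

section Selection

variable {n m : ℕ}

theorem integral_sub_sq_eq_variance_add {Ω : Type*} [MeasurableSpace Ω] {P : Measure Ω}
    [IsProbabilityMeasure P] {X : Ω → ℝ} (hX : MemLp X 2 P) (c : ℝ) :
    ∫ ω, (X ω - c) ^ 2 ∂P = Var[X; P] + (∫ ω, X ω ∂P - c) ^ 2 := by
  have h := variance_eq_sub (hX.sub (memLp_const c))
  simp only [Pi.sub_apply, Pi.pow_apply] at h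
  rw [integral_sub (hX.integrable one_le_two) (integrable_const c), integral_const, probReal_univ,
    one_smul] at h
  rw [← variance_sub_const hX.aestronglyMeasurable c]
  exact (sub_eq_iff_eq_add.1 h.symm)

theorem integral_sq_sum_sub_pi {ι X : Type*} [Fintype ι] [MeasurableSpace X] {ν : Measure X}
    [IsProbabilityMeasure ν] {f : X → ℝ} (hf : MemLp f 2 ν) (c : ℝ) :
    ∫ J, (∑ i, f (J i) - c) ^ 2 ∂(Measure.pi fun _ : ι => ν) =
      Fintype.card ι * Var[f; ν] + (Fintype.card ι * ∫ x, f x ∂ν - c) ^ 2 := by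
  have heval := measurePreserving_eval (fun _ : ι => ν)
  have hmem (i : ι) : MemLp (fun J : ι → X => f (J i)) 2 (Measure.pi fun _ => ν) :=
    hf.comp_measurePreserving (heval i)
  have hmean (i : ι) : ∫ J, f (J i) ∂(Measure.pi fun _ : ι => ν) = ∫ x, f x ∂ν :=
    (heval i).hasLaw.integral_comp hf.aestronglyMeasurable
  have hvar : Var[fun J : ι → X => ∑ i, f (J i); Measure.pi fun _ => ν] =
      Fintype.card ι * Var[f; ν] := by
    simpa [Finset.sum_fn] using variance_sum_pi (μ := fun _ : ι => ν) (X := fun _ => f) fun _ => hf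
  rw [integral_sub_sq_eq_variance_add (memLp_finsetSum Finset.univ fun i _ => hmem i), hvar,
    integral_finsetSum _ fun i _ => (hmem i).integrable one_le_two]
  simp [hmean]

theorem integral_freq_sub_sq_le (hn : 0 < n) (ν : Measure (Fin m)) [IsProbabilityMeasure ν]
    (j : Fin m) (c : ℝ) :
    ∫ J, (freq J j - c) ^ 2 ∂(Measure.pi fun _ : Fin n => ν) ≤
      ν.real {j} / n + (ν.real {j} - c) ^ 2 := by
  have hn' : (0 : ℝ) < n := by positivity
  set f : Fin m → ℝ := Set.indicator {j} 1
  have hfreq (J : Fin n → Fin m) : (freq J j - c) ^ 2 = (∑ i, f (J i) - n * c) ^ 2 / n ^ 2 := by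
    rw [freq, ← Finset.sum_boole, ← div_pow, sub_div, mul_div_cancel_left₀ _ hn'.ne']
    simp only [f, Set.indicator_apply, Set.mem_singleton_iff, Pi.one_apply]
  have hmean : ∫ x, f x ∂ν = ν.real {j} := integral_indicator_one (measurableSet_singleton j)
  have hvar : Var[f; ν] ≤ ν.real {j} := by
    refine (variance_le_expectation_sq (AEStronglyMeasurable.of_discrete)).trans_eq ?_
    rw [← hmean]
    refine integral_congr_ae (.of_forall fun x => ?_)
    by_cases hx : x = j <;> simp [f, hx]
  simp_rw [hfreq]
  rw [integral_div, integral_sq_sum_sub_pi MemLp.of_discrete, hmean, Fintype.card_fin, add_div,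
    ← mul_sub, mul_pow, mul_div_cancel_left₀ _ (by positivity), pow_two (n : ℝ),
    mul_div_mul_left _ _ hn'.ne']
  gcongr

theorem integral_freqDev_le (hn : 0 < n) (ν : Measure (Fin m)) [IsProbabilityMeasure ν] :
    ∫ J, freqDev J ∂(Measure.pi fun _ : Fin n => ν) ≤
      1 / n + ∑ j, (ν.real {j} - 1 / m) ^ 2 := by
  have hsum : ∑ j, ν.real {j} / n = 1 / n := by
    simp [← Finset.sum_div]
  simp only [freqDev]
  rw [integral_finsetSum _ fun j _ => Integrable.of_finite, ← hsum, ← Finset.sum_add_distrib]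
  exact Finset.sum_le_sum fun j _ => integral_freq_sub_sq_le hn ν j (1 / m)

/-- The sum of the labels, coded as `1` and `-1`: a measure of how unbalanced they are. -/
noncomputable def labelSum (y : Fin m → Bool) : ℝ := ∑ j, sgn (y j)

theorem integral_labelSum_sq (m : ℕ) :
    ∫ y, labelSum y ^ 2 ∂(Measure.pi fun _ : Fin m => labelLaw) = m := by
  have hmean : ∫ b, sgn b ∂labelLaw = 0 := by
    norm_num [integral_bernoulliMeasure, half, sgn]
  have hvar : Var[sgn; labelLaw] = 1 := by
    simp [variance_of_integral_eq_zero measurable_sgn.aemeasurable hmean, pow_two, sgn_mul_self]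
  simpa [labelSum, hmean, hvar] using
    integral_sq_sum_sub_pi (ι := Fin m) (ν := labelLaw) (f := sgn) .of_discrete 0

theorem two_mul_card_label (y : Fin m → Bool) (b : Bool) :
    2 * ((Finset.univ.filter fun j => y j = b).card : ℝ) = m + sgn b * labelSum y := by
  have hterm (j : Fin m) : 2 * (if y j = b then 1 else 0 : ℝ) = 1 + sgn b * sgn (y j) := by
    cases y j <;> cases b <;> norm_num [sgn]
  rw [← Finset.sum_boole, Finset.mul_sum, Finset.sum_congr rfl fun j _ => hterm j,
    Finset.sum_add_distrib, ← Finset.mul_sum, labelSum]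
  simp

theorem abs_sgn_mul (b : Bool) (t : ℝ) : |sgn b * t| = |t| := by
  cases b <;> simp [sgn]

theorem exists_label_eq {y' : Fin m → Bool} (hy : 2 * |labelSum y'| < m) (b : Bool) :
    ∃ j, y' j = b := by
  have hcard : 0 < 2 * ((Finset.univ.filter fun j => y' j = b).card : ℝ) := by
    rw [two_mul_card_label]
    linarith [neg_abs_le (sgn b * labelSum y'), abs_sgn_mul b (labelSum y'),
      abs_nonneg (labelSum y')]
  obtain ⟨j, hj⟩ := Finset.card_pos.1 (by exact_mod_cast pos_of_mul_pos_right hcard zero_le_two)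
  exact ⟨j, (Finset.mem_filter.1 hj).2⟩

end Selection

section SelectionLaw

variable {n m : ℕ}

theorem bind_pi {ι X Y : Type*} [Fintype ι] [Countable X] [MeasurableSpace X]
    [DiscreteMeasurableSpace X] [MeasurableSpace Y] (μ : Measure X) [IsProbabilityMeasure μ]
    (κ : X → Measure Y) [∀ x, IsProbabilityMeasure (κ x)] :
    ((Measure.pi fun _ : ι => μ).bind fun x => Measure.pi fun i => κ (x i)) =
      Measure.pi fun _ => μ.bind κ := by
  have : IsProbabilityMeasure (μ.bind κ) :=
    isProbabilityMeasure_bind Measurable.of_discrete.aemeasurable (.of_forall inferInstance)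
  refine (Measure.pi_eq fun t ht => ?_).symm
  have hindep : iIndepFun (fun i (x : ι → X) => κ (x i) (t i)) (Measure.pi fun _ => μ) :=
    iIndepFun_pi (X := fun i x => κ x (t i)) fun i => Measurable.of_discrete.aemeasurable
  rw [Measure.bind_apply (.univ_pi ht) Measurable.of_discrete.aemeasurable]
  simp_rw [Measure.pi_pi]
  rw [lintegral_prod_eq_prod_lintegral_of_indepFun _ _ hindep fun i => .of_discrete]
  refine Finset.prod_congr rfl fun i _ => ?_
  rw [Measure.bind_apply (ht i) Measurable.of_discrete.aemeasurable]
  exact (measurePreserving_eval (fun _ : ι => μ) i).lintegral_comp (f := fun x => κ x (t i))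
    .of_discrete

theorem measureReal_bind {X Y : Type*} [MeasurableSpace X] [MeasurableSpace Y] {μ : Measure X}
    {κ : X → Measure Y} [∀ x, IsFiniteMeasure (κ x)] (hκ : AEMeasurable κ μ) {t : Set Y}
    (ht : MeasurableSet t) : (μ.bind κ).real t = ∫ x, (κ x).real t ∂μ := by
  rw [Measure.real, Measure.bind_apply ht hκ]
  exact (integral_toReal ((Measure.measurable_coe ht).comp_aemeasurable hκ)
    (.of_forall fun x => measure_lt_top _ _)).symm

/-- The law of a selection index given the labels of the known examples, averaged over the label of
the fine-tuning example. -/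
noncomputable def indexLaw (y' : Fin m → Bool) : Measure (Fin m) :=
  labelLaw.bind fun b => uniformOn {j | y' j = b}

theorem isProbabilityMeasure_uniformOn_label {y' : Fin m → Bool} (hy : ∀ b, ∃ j, y' j = b)
    (b : Bool) : IsProbabilityMeasure (uniformOn {j | y' j = b}) :=
  isProbabilityMeasure_uniformOn (Set.toFinite _) (hy b)

theorem isProbabilityMeasure_indexLaw {y' : Fin m → Bool} (hy : ∀ b, ∃ j, y' j = b) :
    IsProbabilityMeasure (indexLaw y') :=
  isProbabilityMeasure_bind Measurable.of_discrete.aemeasurable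
    (.of_forall (isProbabilityMeasure_uniformOn_label hy))

theorem uniformOn_label_real_singleton (y' : Fin m → Bool) (b : Bool) (j : Fin m) :
    (uniformOn {j | y' j = b}).real {j} =
      if y' j = b then ((Finset.univ.filter fun j => y' j = b).card : ℝ)⁻¹ else 0 := by
  have hset : {j | y' j = b} = ((Finset.univ.filter fun j => y' j = b : Finset _) : Set _) := by
    ext; simp
  rw [Measure.real, hset, ← Finset.coe_singleton, uniformOn_apply_finset]
  split_ifs with h
  · rw [Finset.inter_singleton_of_mem (by simp [h])]
    simp
  · rw [Finset.inter_singleton_of_notMem (by simp [h])]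
    simp

theorem indexLaw_real_singleton {y' : Fin m → Bool} (hy : ∀ b, ∃ j, y' j = b) (j : Fin m) :
    (indexLaw y').real {j} = (m + sgn (y' j) * labelSum y')⁻¹ := by
  have (b : Bool) := isProbabilityMeasure_uniformOn_label hy b
  rw [indexLaw, measureReal_bind Measurable.of_discrete.aemeasurable (measurableSet_singleton j),
    integral_bernoulliMeasure, uniformOn_label_real_singleton, uniformOn_label_real_singleton,
    ← two_mul_card_label]
  cases y' j <;> norm_num [half] <;> ring

theorem sum_indexLaw_sub_sq_le {y' : Fin m → Bool} (hy : 2 * |labelSum y'| < m) :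
    ∑ j, ((indexLaw y').real {j} - 1 / m) ^ 2 ≤ 4 * labelSum y' ^ 2 / m ^ 3 := by
  have hm : (0 : ℝ) < m := by linarith [abs_nonneg (labelSum y')]
  have hterm (j : Fin m) :
      ((indexLaw y').real {j} - 1 / m) ^ 2 ≤ 4 * labelSum y' ^ 2 / m ^ 4 := by
    rw [indexLaw_real_singleton (exists_label_eq hy)]
    rw [← abs_sgn_mul (y' j)] at hy
    rw [← sq_abs (labelSum y'), ← abs_sgn_mul (y' j), sq_abs]
    generalize sgn (y' j) * labelSum y' = t at hy ⊢
    have hlow : (m : ℝ) / 2 ≤ m + t := by linarith [neg_abs_le t]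
    have hpos : (0 : ℝ) < m + t := by linarith
    calc ((m + t)⁻¹ - 1 / m) ^ 2 = t ^ 2 / (m ^ 2 * (m + t) ^ 2) := by field_simp; ring
      _ ≤ t ^ 2 / (m ^ 2 * (m / 2) ^ 2) := by gcongr
      _ = 4 * t ^ 2 / m ^ 4 := by field_simp; ring
  calc ∑ j, ((indexLaw y').real {j} - 1 / m) ^ 2 ≤ ∑ _j : Fin m, 4 * labelSum y' ^ 2 / m ^ 4 :=
        Finset.sum_le_sum fun j _ => hterm j
    _ = 4 * labelSum y' ^ 2 / m ^ 3 := by simp; field_simp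

theorem isProbabilityMeasure_selectLaw (hm : 0 < m) (y : Fin n → Bool) (y' : Fin m → Bool) :
    IsProbabilityMeasure (selectLaw y y') := by
  classical
  have : Nonempty (Fin m) := ⟨⟨0, hm⟩⟩
  have (i : Fin n) : IsProbabilityMeasure
      (if ∃ j, y' j = y i then uniformOn {j | y' j = y i} else uniformOn Set.univ) := by
    split_ifs with h
    · exact isProbabilityMeasure_uniformOn (Set.toFinite _) h
    · infer_instance
  unfold selectLaw
  convert! Measure.pi.instIsProbabilityMeasure fun i =>
    if ∃ j, y' j = y i then uniformOn {j | y' j = y i} else uniformOn Set.univ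

theorem isMarkovKernel_selectKernel (hm : 0 < m) : IsMarkovKernel (selectKernel n m) :=
  ⟨fun ys => isProbabilityMeasure_selectLaw hm ys.1 ys.2⟩

theorem selectLaw_eq_pi_uniformOn {y' : Fin m → Bool} (hy : ∀ b, ∃ j, y' j = b)
    (y : Fin n → Bool) : selectLaw y y' = Measure.pi fun i => uniformOn {j | y' j = y i} := by
  simp only [selectLaw, hy, if_true]

theorem bind_selectLaw {y' : Fin m → Bool} (hy : ∀ b, ∃ j, y' j = b) :
    ((Measure.pi fun _ : Fin n => labelLaw).bind fun y => selectLaw y y') =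
      Measure.pi fun _ => indexLaw y' := by
  have (b : Bool) := isProbabilityMeasure_uniformOn_label hy b
  simp_rw [selectLaw_eq_pi_uniformOn hy]
  exact bind_pi labelLaw fun b => uniformOn {j | y' j = b}

theorem ae_selectLaw_label_eq {y' : Fin m → Bool} (hy : ∀ b, ∃ j, y' j = b) (y : Fin n → Bool) :
    ∀ᵐ J ∂selectLaw y y', ∀ i, y' (J i) = y i := by
  have (b : Bool) := isProbabilityMeasure_uniformOn_label hy b
  rw [selectLaw_eq_pi_uniformOn hy, ae_all_iff]
  exact fun i => (Measure.tendsto_eval_ae_ae (μ := fun i => uniformOn {j | y' j = y i})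
    (i := i)).eventually (p := fun j => y' j = y i) (ae_cond_mem .of_discrete)

end SelectionLaw

section TrialLaw

theorem measurePreserving_compProd_comap {Ω X Y Z : Type*} [MeasurableSpace Ω] [MeasurableSpace X]
    [MeasurableSpace Y] [MeasurableSpace Z] {P : Measure Ω} [SFinite P] {μ : Measure X}
    [IsFiniteMeasure μ] {ν : Measure Z} [IsFiniteMeasure ν] {κ : Kernel X Y} [IsFiniteKernel κ]
    {f : Ω → X} {g : Ω → Z} (hf : Measurable f) (hg : Measurable g)
    (hfg : MeasurePreserving (fun ω => (f ω, g ω)) P (μ.prod ν)) :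
    MeasurePreserving (fun z : Ω × Y => ((f z.1, z.2), g z.1)) (P ⊗ₘ κ.comap f hf)
      ((μ ⊗ₘ κ).prod ν) := by
  have hmeas : Measurable fun z : Ω × Y => ((f z.1, z.2), g z.1) := by fun_prop
  refine ⟨hmeas, (Measure.prod_eq fun s t hs ht => ?_).symm⟩
  have hsection (ω : Ω) : κ (f ω) (Prod.mk ω ⁻¹'
        ((fun z : Ω × Y => ((f z.1, z.2), g z.1)) ⁻¹' s ×ˢ t)) =
      κ (f ω) (Prod.mk (f ω) ⁻¹' s) * t.indicator 1 (g ω) := by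
    by_cases hω : g ω ∈ t <;> simp [hω, Set.preimage_preimage, Set.mk_preimage_prod]
  rw [Measure.map_apply hmeas (hs.prod ht), Measure.compProd_apply (hmeas (hs.prod ht))]
  simp only [Kernel.comap_apply, hsection]
  rw [hfg.lintegral_comp (f := fun z => κ z.1 (Prod.mk z.1 ⁻¹' s) * t.indicator 1 z.2)
      (((Kernel.measurable_kernel_prodMk_left hs).comp measurable_fst).mul
        ((measurable_one.indicator ht).comp measurable_snd)),
    lintegral_prod_mul (Kernel.measurable_kernel_prodMk_left hs).aemeasurable
      (measurable_one.indicator ht).aemeasurable,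
    lintegral_indicator_one ht, Measure.compProd_apply hs]

variable {n m D : ℕ}

theorem measurePreserving_labels_selection_signedInputs (hm : 0 < m) (σ₁ σξ : ℝ≥0)
    (p : unitInterval) :
    MeasurePreserving (fun T : Trial n (D + 2) m => ((labels T.1, T.2), signedInputs T.1))
      (trialLaw n (D + 2) m σ₁ 0 σξ p)
      ((labelsLaw n m ⊗ₘ selectKernel n m).prod
        (sampleLaw (signedCoreLaws σ₁ p) (gaussianReal 0 (σξ ^ 2 / D)))) := by
  have := isMarkovKernel_selectKernel (n := n) hm
  have h := measurePreserving_labels_signedInputs n m D σ₁ σξ p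
  have key := measurePreserving_compProd_comap (κ := selectKernel n m) measurable_labels
    h.measurable.snd h
  exact key

/-- Every fine-tuning example is mixed with a known example of the same label; `ys` are the labels
in the two data sets and `J` the selection. -/
def LabelMatched (ys : (Fin n → Bool) × (Fin m → Bool)) (J : Fin n → Fin m) : Prop :=
  ∀ i, ys.2 (J i) = ys.1 i

theorem trialLaw_preimage_eq_lintegral (hm : 0 < m) (σ₁ σξ : ℝ≥0) (p : unitInterval)
    {E : Set ((((Fin n → Bool) × (Fin m → Bool)) × (Fin n → Fin m)) × (CoordIdx n m D → ℝ))}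
    (hE : MeasurableSet E) :
    trialLaw n (D + 2) m σ₁ 0 σξ p {T | ((labels T.1, T.2), signedInputs T.1) ∈ E} =
      ∫⁻ y', ∫⁻ y, ∫⁻ J, sampleLaw (signedCoreLaws σ₁ p) (gaussianReal 0 (σξ ^ 2 / D))
          {x | (((y, y'), J), x) ∈ E}
        ∂selectLaw y y' ∂(Measure.pi fun _ => labelLaw) ∂(Measure.pi fun _ => labelLaw) := by
  have := isMarkovKernel_selectKernel (n := n) hm
  have hmp := measurePreserving_labels_selection_signedInputs (n := n) (D := D) hm σ₁ σξ p
  calc _ = _ := hmp.measure_preimage hE.nullMeasurableSet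
    _ = _ := Measure.prod_apply hE
    _ = _ := Measure.lintegral_compProd .of_discrete
    _ = _ := lintegral_prod_symm _ Measurable.of_discrete.aemeasurable

theorem lintegral_ofReal_add_mul_freqDev_le (hn : 0 < n) {y' : Fin m → Bool}
    (hy : 2 * |labelSum y'| < m) {A B : ℝ} (hA : 0 ≤ A) (hB : 0 ≤ B) :
    ∫⁻ y, ∫⁻ J, ENNReal.ofReal (A + B * freqDev J) ∂selectLaw y y'
        ∂(Measure.pi fun _ : Fin n => labelLaw) ≤
      ENNReal.ofReal (A + B * (1 / n + 4 * labelSum y' ^ 2 / m ^ 3)) := by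
  have hlabel := exists_label_eq hy
  have := isProbabilityMeasure_indexLaw hlabel
  have hfreq : ∫ J, freqDev J ∂(Measure.pi fun _ : Fin n => indexLaw y') ≤
      1 / n + 4 * labelSum y' ^ 2 / m ^ 3 :=
    (integral_freqDev_le hn _).trans (by gcongr; exact sum_indexLaw_sub_sq_le hy)
  rw [← Measure.lintegral_bind Measurable.of_discrete.aemeasurable
      Measurable.of_discrete.aemeasurable, bind_selectLaw hlabel,
    ← ofReal_integral_eq_lintegral_ofReal .of_finite
      (.of_forall fun J => add_nonneg hA (mul_nonneg hB (freqDev_nonneg J))),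
    integral_add .of_finite .of_finite, integral_const_mul, integral_const, probReal_univ, one_smul]
  gcongr

theorem lintegral_selectLaw_le (hn : 0 < n) (hm : 0 < m) (y' : Fin m → Bool) {A B : ℝ}
    (hA : 0 ≤ A) (hB : 0 ≤ B) {G : (Fin n → Bool) → (Fin n → Fin m) → ℝ≥0∞}
    (hG_one : ∀ y J, G y J ≤ 1)
    (hG : ∀ y J, LabelMatched (y, y') J → G y J ≤ ENNReal.ofReal (A + B * freqDev J)) :
    ∫⁻ y, ∫⁻ J, G y J ∂selectLaw y y' ∂(Measure.pi fun _ : Fin n => labelLaw) ≤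
      ENNReal.ofReal
        (4 * labelSum y' ^ 2 / m ^ 2 + (A + B * (1 / n + 4 * labelSum y' ^ 2 / m ^ 3))) := by
  have hrest : 0 ≤ A + B * (1 / n + 4 * labelSum y' ^ 2 / m ^ 3) := by positivity
  rcases lt_or_ge (2 * |labelSum y'|) m with hy | hy
  · calc _ ≤ ∫⁻ y, ∫⁻ J, ENNReal.ofReal (A + B * freqDev J) ∂selectLaw y y'
            ∂(Measure.pi fun _ : Fin n => labelLaw) :=
          lintegral_mono fun y => lintegral_mono_ae <|
            (ae_selectLaw_label_eq (exists_label_eq hy) y).mono fun J hJ => hG y J hJ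
      _ ≤ _ := lintegral_ofReal_add_mul_freqDev_le hn hy hA hB
      _ ≤ _ := ENNReal.ofReal_le_ofReal (le_add_of_nonneg_left (by positivity))
  · have hone : (1 : ℝ) ≤ 4 * labelSum y' ^ 2 / m ^ 2 := by
      rw [one_le_div (by positivity), ← sq_abs (labelSum y')]
      calc (m : ℝ) ^ 2 ≤ (2 * |labelSum y'|) ^ 2 := by gcongr
        _ = 4 * |labelSum y'| ^ 2 := by ring
    have (y : Fin n → Bool) := isProbabilityMeasure_selectLaw hm y y'
    calc _ ≤ ∫⁻ y, ∫⁻ _J, 1 ∂selectLaw y y' ∂(Measure.pi fun _ : Fin n => labelLaw) :=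
          lintegral_mono fun y => lintegral_mono fun J => hG_one y J
      _ = ENNReal.ofReal 1 := by simp
      _ ≤ _ := ENNReal.ofReal_le_ofReal (le_add_of_le_of_nonneg hone hrest)

theorem trialLaw_not_labelMatched_or_mem_le (hn : 0 < n) (hm : 0 < m) (σ₁ σξ : ℝ≥0)
    (p : unitInterval) {A B : ℝ} (hA : 0 ≤ A) (hB : 0 ≤ B)
    {bad : (Fin n → Fin m) → Set (CoordIdx n m D → ℝ)} (hbad : ∀ J, MeasurableSet (bad J))
    (hle : ∀ J, sampleLaw (signedCoreLaws σ₁ p) (gaussianReal 0 (σξ ^ 2 / D)) (bad J) ≤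
      ENNReal.ofReal (A + B * freqDev J)) :
    trialLaw n (D + 2) m σ₁ 0 σξ p
        {T | ¬ LabelMatched (labels T.1) T.2 ∨ signedInputs T.1 ∈ bad T.2} ≤
      ENNReal.ofReal (4 / m + A + B * (1 / n + 4 / m ^ 2)) := by
  have hE : MeasurableSet {z : (((Fin n → Bool) × (Fin m → Bool)) × (Fin n → Fin m)) ×
      (CoordIdx n m D → ℝ) | ¬ LabelMatched z.1.1 z.1.2 ∨ z.2 ∈ bad z.1.2} :=
    measurableSet_setOfPred.2 <| measurable_from_prod_countable_right fun z =>
      measurableSet_setOfPred.1 <|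
        show MeasurableSet {x | ¬ LabelMatched z.1 z.2 ∨ x ∈ bad z.2} from
          (MeasurableSet.const _).union (hbad z.2)
  have hmean : ∫ y', (4 * labelSum y' ^ 2 / m ^ 2 + (A + B * (1 / n + 4 * labelSum y' ^ 2 / m ^ 3)))
      ∂(Measure.pi fun _ : Fin m => labelLaw) = 4 / m + A + B * (1 / n + 4 / m ^ 2) := by
    calc _ = ∫ y', ((4 / m ^ 2 + B * 4 / m ^ 3) * labelSum y' ^ 2 + (A + B / n))
          ∂(Measure.pi fun _ : Fin m => labelLaw) := by congr! 2; ring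
      _ = (4 / m ^ 2 + B * 4 / m ^ 3) * m + (A + B / n) := by
        rw [integral_add .of_finite .of_finite, integral_const_mul, integral_labelSum_sq]
        simp
      _ = _ := by field_simp; ring
  rw [← hmean, ofReal_integral_eq_lintegral_ofReal .of_finite
    (.of_forall fun y' => by positivity)]
  refine (trialLaw_preimage_eq_lintegral hm σ₁ σξ p hE).trans_le (lintegral_mono fun y' => ?_)
  refine lintegral_selectLaw_le hn hm y' hA hB (fun y J => prob_le_one) fun y J hJ => ?_
  simpa [hJ] using hle J

end TrialLaw

section TrainLoss

variable {n m D : ℕ}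

theorem trainLoss_eq_of_labelMatched (θ : Params) {T : Trial n (D + 2) m}
    (hT : LabelMatched (labels T.1) T.2) (w : Fin (D + 2) → ℝ) :
    trainLoss θ.s θ.lam T w =
      (n : ℝ)⁻¹ * ∑ i, (θ.mix T.2 (signedInputs T.1) i ⬝ᵥ w - 1) ^ 2 + θ.lam * ∑ k, w k ^ 2 := by
  have hres (i : Fin n) : θ.mix T.2 (signedInputs T.1) i ⬝ᵥ w - 1 =
      sgn (T.1.1 i).label * (mixedInput θ.s T i ⬝ᵥ w - sgn (T.1.1 i).label) := by
    have hmix : θ.mix T.2 (signedInputs T.1) i = sgn (T.1.1 i).label • mixedInput θ.s T i := by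
      have hlabel : (T.1.2 (T.2 i)).label = (T.1.1 i).label := hT i
      ext k
      simp only [Params.mix, signedInputs, mixedInput, Sum.elim_inl, Sum.elim_inr, hlabel,
        Pi.smul_apply, Pi.add_apply, smul_eq_mul]
      ring
    rw [hmix, smul_dotProduct, smul_eq_mul, mul_sub, sgn_mul_self]
  simp only [trainLoss, hres, mul_pow, sq (sgn _), sgn_mul_self, one_mul, div_eq_inv_mul]

theorem sum_sq_le_of_isMinOn_trainLoss {d : ℕ} {s lam : ℝ} (hlam : 0 < lam) {T : Trial n d m}
    {w : Fin d → ℝ} (hw : IsMinOn (trainLoss s lam T) Set.univ w) : ∑ l, w l ^ 2 ≤ 1 / lam := by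
  have hzero : trainLoss s lam T 0 ≤ 1 := by
    simpa [trainLoss, sq (sgn _), sgn_mul_self] using div_self_le_one (n : ℝ)
  rw [le_div_iff₀' hlam]
  calc lam * ∑ l, w l ^ 2 ≤ trainLoss s lam T w := le_add_of_nonneg_left (by positivity)
    _ ≤ trainLoss s lam T 0 := hw (Set.mem_univ 0)
    _ ≤ 1 := hzero

theorem sub_sq_add_sub_sq_le_distBound (θ : Params) {T : Trial n (D + 2) m}
    (hT : LabelMatched (labels T.1) T.2) {w : Fin (D + 2) → ℝ}
    (hw : IsMinOn (trainLoss θ.s θ.lam T) Set.univ w) :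
    (w 0 - θ.a) ^ 2 + (w 1 - θ.b) ^ 2 ≤ θ.distBound T.2 (signedInputs T.1) := by
  have hmin := hw (Set.mem_univ (θ.comparison (signedInputs T.1)))
  simp only [Set.mem_ofPred_eq, trainLoss_eq_of_labelMatched θ hT] at hmin
  refine le_trans ?_ (θ.sum_sub_comparison_sq_le_distBound T.2 (signedInputs T.1) w hmin)
  rw [Fin.sum_univ_succ, Fin.sum_univ_succ, ← add_assoc]
  exact le_add_of_nonneg_right (by positivity)

end TrainLoss

section TestLoss

theorem restrict_dataLaw_attr_ne_label (d : ℕ) (σ₁ σ₂ σξ : ℝ≥0) {μ : ℝ} (hμ : μ ≤ 1) :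
    (dataLaw d σ₁ σ₂ σξ μ).restrict {e | e.attr ≠ e.label} =
      ENNReal.ofReal (1 - μ) • dataLaw d σ₁ σ₂ σξ 0 := by
  have hset : {e : Example d | e.attr ≠ e.label} = Set.univ ×ˢ {c | c.2 ≠ c.1} := by
    ext e; simp
  have hprod (y a : Bool) : ((inputLaw d σ₁ σ₂ σξ y a).prod (Measure.dirac (y, a))).restrict
      {e : Example d | e.attr ≠ e.label} =
      if a = y then 0 else (inputLaw d σ₁ σ₂ σξ y a).prod (Measure.dirac (y, a)) := by
    classical
    rw [hset, ← Measure.prod_restrict, Measure.restrict_univ, restrict_dirac]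
    by_cases h : a = y <;> simp [h]
  have hweight : ENNReal.ofReal (1 / 2 * (1 - μ)) =
      ENNReal.ofReal (1 - μ) * ENNReal.ofReal (1 / 2) := by
    rw [mul_comm, ENNReal.ofReal_mul (sub_nonneg.2 hμ)]
  simp only [dataLaw, Fintype.sum_bool, Measure.restrict_add, Measure.restrict_smul, hprod,
    hweight, if_true, reduceCtorEq, if_false, sub_zero, mul_one, mul_zero, ENNReal.ofReal_zero,
    smul_zero, zero_smul, zero_add, add_zero, smul_add, smul_smul]

theorem cond_dataLaw_attr_ne_label (d : ℕ) (σ₁ σ₂ σξ : ℝ≥0)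
    [IsProbabilityMeasure (dataLaw d σ₁ σ₂ σξ 0)] {μ : ℝ} (hμ : μ < 1) :
    cond (dataLaw d σ₁ σ₂ σξ μ) {e | e.attr ≠ e.label} = dataLaw d σ₁ σ₂ σξ 0 := by
  have hrestrict := restrict_dataLaw_attr_ne_label d σ₁ σ₂ σξ hμ.le
  rw [ProbabilityTheory.cond, ← Measure.restrict_apply_univ, hrestrict, Measure.smul_apply,
    measure_univ, smul_eq_mul, mul_one, smul_smul,
    ENNReal.inv_mul_cancel (by simpa using hμ) ENNReal.ofReal_ne_top, one_smul]

theorem integral_dotProduct_sub_one_sq_signedInputLaw (D : ℕ) (σ₁ τ : ℝ≥0)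
    (w : Fin (D + 2) → ℝ) :
    ∫ x, (x ⬝ᵥ w - 1) ^ 2 ∂signedInputLaw D σ₁ τ (Measure.dirac (-1)) =
      (w 0 - w 1 - 1) ^ 2 + σ₁ ^ 2 * w 0 ^ 2 + τ * ∑ l : Fin D, w l.succ.succ ^ 2 := by
  let c : Fin (D + 2) → ℝ := Fin.cons 1 (Fin.cons (-1) 0)
  let v : Fin (D + 2) → ℝ≥0 := Fin.cons (σ₁ ^ 2) (Fin.cons 0 fun _ => τ)
  have hlaw : coordLaw (signedCoreLaw σ₁ (Measure.dirac (-1))) (gaussianReal 0 τ) =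
      fun k => gaussianReal (c k) (v k) := by
    funext k
    induction k using Fin.cases with
    | zero => rfl
    | succ k =>
      induction k using Fin.cases with
      | zero => exact (gaussianReal_zero_var (-1)).symm
      | succ l => rfl
  have haffine (x : Fin (D + 2) → ℝ) :
      x ⬝ᵥ w - 1 = (w 0 - w 1 - 1) + ∑ k, w k * (x k - c k) := by
    have hc : ∑ k, w k * c k = w 0 - w 1 := by
      simp [Fin.sum_univ_succ, c, sub_eq_add_neg]
    rw [dotProduct_comm, dotProduct]
    simp only [mul_sub, Finset.sum_sub_distrib, hc]
    ring
  simp only [signedInputLaw, hlaw, haffine]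
  simp only [sq (_ + ∑ k, w k * _)]
  rw [integral_affine_mul_affine_pi _ (fun k => integral_sub_mean_gaussianReal (c k) (v k))
    fun k => integral_sub_mean_sq_gaussianReal (c k) (v k)]
  simp only [Fin.sum_univ_succ, v, Fin.cons_zero, Fin.cons_succ, ← Finset.sum_mul]
  push_cast
  ring_nf

theorem testLoss_eq (D : ℕ) (σ₁ σξ : ℝ≥0) {μ : ℝ} (hμ : μ < 1) (w : Fin (D + 2) → ℝ) :
    testLoss (D + 2) σ₁ 0 σξ μ w = (w 0 - w 1 - 1) ^ 2 + σ₁ ^ 2 * w 0 ^ 2 +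
      σξ ^ 2 / D * ∑ l : Fin D, w l.succ.succ ^ 2 := by
  have : IsProbabilityMeasure (dataLaw (D + 2) σ₁ 0 σξ 0) :=
    isProbabilityMeasure_dataLaw D σ₁ σξ 0
  have hsigned := measurePreserving_signedExample D σ₁ σξ 0
  have hres (e : Example (D + 2)) : (e.input ⬝ᵥ w - sgn e.label) ^ 2 =
      ((signedExample e).2 ⬝ᵥ w - 1) ^ 2 := by
    have : (signedExample e).2 ⬝ᵥ w - 1 = sgn e.label * (e.input ⬝ᵥ w - sgn e.label) := by
      rw [signedExample, smul_dotProduct, smul_eq_mul, mul_sub, sgn_mul_self]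
    rw [this, mul_pow, sq (sgn _), sgn_mul_self, one_mul]
  have hmeas : Measurable fun x : Fin (D + 2) → ℝ => (x ⬝ᵥ w - 1) ^ 2 := by
    unfold dotProduct; fun_prop
  simp only [testLoss, cond_dataLaw_attr_ne_label _ _ _ _ hμ, hres]
  rw [bernoulliMeasure_zero] at hsigned
  calc _ = ∫ x, (x ⬝ᵥ w - 1) ^ 2 ∂signedInputLaw D σ₁ (σξ ^ 2 / D) (Measure.dirac (-1)) :=
        (measurePreserving_snd.comp hsigned).hasLaw.integral_comp hmeas.aestronglyMeasurable
    _ = _ := by rw [integral_dotProduct_sub_one_sq_signedInputLaw]; push_cast; rfl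

end TestLoss

section Tail

theorem Params.measurable_distBound (θ : Params) {n m D : ℕ} (J : Fin n → Fin m) :
    Measurable (θ.distBound J : (CoordIdx n m D → ℝ) → ℝ) := by
  unfold distBound errFt errKnown gradMain mix comparison noiseWeight mainRes resFt resKnown
  fun_prop

theorem Params.distBound_nonneg (θ : Params) {n m D : ℕ} (J : Fin n → Fin m)
    (x : CoordIdx n m D → ℝ) : 0 ≤ θ.distBound J x := by
  have := θ.lam_pos
  unfold distBound
  positivity

theorem exists_trialLaw_not_labelMatched_or_le_distBound_le {θ : Params} {σ₁ : ℝ≥0}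
    {p : unitInterval} (hθ : θ.IsStationary (signedCoreLaws σ₁ p)) {η : ℝ} (hη : 0 < η) :
    ∃ C, 0 ≤ C ∧ ∀ {n m D : ℕ} {σξ : ℝ≥0}, 0 < n → 0 < m → 0 < D → (σξ : ℝ) ^ 2 / m = θ.r →
      trialLaw n (D + 2) m σ₁ 0 σξ p
          {T | ¬ LabelMatched (labels T.1) T.2 ∨ η ≤ θ.distBound T.2 (signedInputs T.1)} ≤
        ENNReal.ofReal (C * (1 / m + m / D + m / n)) := by
  obtain ⟨C, hC, hbound⟩ :=
    hθ.exists_integral_distBound_le (K := ∫ t, (t ^ 2 - 1) ^ 2 ∂gaussianReal 0 1)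
      (integral_nonneg fun t => sq_nonneg (t ^ 2 - 1))
  refine ⟨4 + 5 * (C / η), by positivity, fun {n m D σξ} hn hm hD hσ => ?_⟩
  have hτ : D * ((σξ ^ 2 / D : ℝ≥0) : ℝ) = θ.r * m := by
    rw [← hσ]; push_cast; field_simp
  have htail (J : Fin n → Fin m) :
      sampleLaw (signedCoreLaws σ₁ p) (gaussianReal 0 (σξ ^ 2 / D))
          {x : CoordIdx n m D → ℝ | η ≤ θ.distBound J x} ≤
        ENNReal.ofReal (C / η * (m / D + m / n + 1 / m) + C / η * m * freqDev J) := by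
    have hmarkov := mul_meas_ge_le_integral_of_nonneg
      (μ := sampleLaw (D := D) (signedCoreLaws σ₁ p) (gaussianReal 0 (σξ ^ 2 / D)))
      (ae_of_all _ (θ.distBound_nonneg J)) (θ.hasMoments_distBound J).integrable η
    rw [← ofReal_measureReal]
    refine ENNReal.ofReal_le_ofReal ?_
    calc _ ≤ C * (m / D + m / n + m * freqDev J + 1 / m) / η := by
          rw [le_div_iff₀' hη]
          exact hmarkov.trans (hbound hn hm hD (noiseMoments_gaussianReal _) hτ J)
      _ = _ := by ring
  refine (trialLaw_not_labelMatched_or_mem_le hn hm σ₁ σξ p (by positivity) (by positivity)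
    (fun J => measurableSet_le measurable_const (θ.measurable_distBound J)) htail).trans
    (ENNReal.ofReal_le_ofReal ?_)
  have : 0 ≤ C / η * (3 * (m / n) + 4 * (m / D)) + 4 * ((m : ℝ) / D + m / n) := by positivity
  calc _ = (4 + 5 * (C / η)) * (1 / m + m / D + m / n) -
        (C / η * (3 * (m / n) + 4 * (m / D)) + 4 * ((m : ℝ) / D + m / n)) := by
        field_simp; ring
    _ ≤ _ := sub_le_self _ this

theorem exists_dist_testLoss_lt (σ₁ : ℝ≥0) (a b : ℝ) {μ : ℝ} (hμ : μ < 1) {ε : ℝ} (hε : 0 < ε) :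
    ∃ η > 0, ∀ {D : ℕ} {σξ : ℝ≥0} {w : Fin (D + 2) → ℝ},
      (w 0 - a) ^ 2 + (w 1 - b) ^ 2 < η ^ 2 → σξ ^ 2 / D * ∑ l : Fin D, w l.succ.succ ^ 2 < η →
      dist (testLoss (D + 2) σ₁ 0 σξ μ w) ((a - b - 1) ^ 2 + σ₁ ^ 2 * a ^ 2) < ε := by
  let F : ℝ × ℝ × ℝ → ℝ := fun z => (z.1 - z.2.1 - 1) ^ 2 + (σ₁ : ℝ) ^ 2 * z.1 ^ 2 + z.2.2
  have hF : Continuous F := by fun_prop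
  obtain ⟨η, hη, hηF⟩ := Metric.continuous_iff.1 hF (a, b, 0) ε hε
  refine ⟨η, hη, fun {D σξ w} hcore hnoise => ?_⟩
  have hfst : |w 0 - a| < η :=
    abs_lt_of_sq_lt_sq ((le_add_of_nonneg_right (sq_nonneg _)).trans_lt hcore) hη.le
  have hsnd : |w 1 - b| < η :=
    abs_lt_of_sq_lt_sq ((le_add_of_nonneg_left (sq_nonneg _)).trans_lt hcore) hη.le
  rw [testLoss_eq _ _ _ hμ]
  simpa [F] using hηF (w 0, w 1, σξ ^ 2 / D * ∑ l : Fin D, w l.succ.succ ^ 2) <| by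
    simp only [Prod.dist_eq, max_lt_iff, Real.dist_eq, sub_zero]
    exact ⟨hfst, hsnd, by rwa [abs_of_nonneg (by positivity)]⟩

theorem isProbabilityMeasure_trialLaw {n m D : ℕ} (hm : 0 < m) (σ₁ σξ : ℝ≥0)
    (p : unitInterval) : IsProbabilityMeasure (trialLaw n (D + 2) m σ₁ 0 σξ p) := by
  have := isMarkovKernel_selectKernel (n := n) hm
  exact inferInstanceAs
    (IsProbabilityMeasure (dataSetsLaw n m D σ₁ σξ p ⊗ₘ (selectKernel n m).comap _ _))

theorem sum_noise_sq_le_of_isMinOn_trainLoss {s lam : ℝ} (hlam : 0 < lam) {n m D : ℕ}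
    {T : Trial n (D + 2) m} {w : Fin (D + 2) → ℝ}
    (hw : IsMinOn (trainLoss s lam T) Set.univ w) :
    ∑ l : Fin D, w l.succ.succ ^ 2 ≤ 1 / lam := by
  refine le_trans ?_ (sum_sq_le_of_isMinOn_trainLoss hlam hw)
  rw [Fin.sum_univ_succ, Fin.sum_univ_succ, ← add_assoc]
  exact le_add_of_nonneg_left (by positivity)

theorem exists_dist_testLoss_limitLoss_lt {s r lam μ ε : ℝ} (σ₁ : ℝ≥0) (p : unitInterval)
    (hr : 0 ≤ r) (hlam : 0 < lam) (hμ : μ < 1) (hε : 0 < ε) :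
    ∃ η > 0, ∀ {n m D : ℕ} {σξ : ℝ≥0} {T : Trial n (D + 2) m} {w : Fin (D + 2) → ℝ},
      0 < m → (σξ : ℝ) ^ 2 / m = r → IsMinOn (trainLoss s lam T) Set.univ w →
      LabelMatched (labels T.1) T.2 →
      (limitParams s p σ₁ hr hlam).distBound T.2 (signedInputs T.1) < η ^ 2 →
      r / lam * (m / D) < η →
      dist (testLoss (D + 2) σ₁ 0 σξ μ w) (limitLoss s p r lam σ₁) < ε := by
  set θ := limitParams s p σ₁ hr hlam
  obtain ⟨η, hη, hclose⟩ := exists_dist_testLoss_lt σ₁ θ.a θ.b hμ hε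
  refine ⟨η, hη, fun {n m D σξ T w} hm hσ hw hT hdist hnoise => ?_⟩
  rw [limitLoss_eq hr hlam]
  have hcore := (sub_sq_add_sub_sq_le_distBound θ hT hw).trans_lt hdist
  refine hclose hcore (lt_of_le_of_lt ?_ hnoise)
  calc (σξ : ℝ) ^ 2 / D * ∑ l : Fin D, w l.succ.succ ^ 2
      ≤ (σξ : ℝ) ^ 2 / D * (1 / lam) := by
        gcongr
        exact sum_noise_sq_le_of_isMinOn_trainLoss hlam hw
    _ = r / lam * (m / D) := by rw [← hσ]; field_simp

theorem exists_trialLaw_le_dist_testLoss_le {s r lam μ ε : ℝ} (σ₁ : ℝ≥0) (p : unitInterval)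
    (hr : 0 ≤ r) (hlam : 0 < lam) (hμ : μ < 1) (hε : 0 < ε) :
    ∃ C, ∀ {n d m : ℕ} {σξ : ℝ≥0}, 0 < n → 0 < m → 3 ≤ d → m ≤ d → (σξ : ℝ) ^ 2 / m = r →
      trialLaw n d m σ₁ 0 σξ p {T | ∃ w, IsMinOn (trainLoss s lam T) Set.univ w ∧
          ε ≤ dist (testLoss d σ₁ 0 σξ μ w) (limitLoss s p r lam σ₁)} ≤
        ENNReal.ofReal (C * (1 / m + m / d + d / n)) := by
  obtain ⟨η, hη, hclose⟩ := exists_dist_testLoss_limitLoss_lt (s := s) σ₁ p hr hlam hμ hε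
  obtain ⟨C, hC, htail⟩ := exists_trialLaw_not_labelMatched_or_le_distBound_le
    (isStationary_limitParams (s := s) p.2 hr hlam (coreMoments_signedCoreLaws σ₁ p))
    (sq_pos_of_pos hη)
  refine ⟨3 * (C + r / (lam * η)), fun {n d m σξ} hn hm hd hmd hσ => ?_⟩
  obtain ⟨D, rfl⟩ : ∃ D, d = D + 2 := ⟨d - 2, by omega⟩
  have hD : 0 < D := by omega
  have hmD : (m : ℝ) / D ≤ 3 * (m / (D + 2 : ℕ)) := by
    have : (1 : ℝ) ≤ D := by exact_mod_cast hD
    rw [← mul_div_assoc, div_le_div_iff₀ (by positivity) (by positivity)]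
    push_cast
    nlinarith
  have hrate : (1 : ℝ) / m + m / D + m / n ≤ 3 * (1 / m + m / (D + 2 : ℕ) + (D + 2 : ℕ) / n) := by
    have : (m : ℝ) / n ≤ (D + 2 : ℕ) / n := by gcongr
    linarith [show 0 ≤ (1 : ℝ) / m by positivity, show 0 ≤ (m : ℝ) / n by positivity]
  rcases lt_or_ge (r / lam * (m / D)) η with hnoise | hnoise
  · refine (measure_mono ?_).trans ((htail hn hm hD hσ).trans (ENNReal.ofReal_le_ofReal ?_))
    · rintro T ⟨w, hw, hdist⟩
      by_contra hgood
      simp only [Set.mem_ofPred_eq, not_or, not_not, not_le] at hgood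
      exact hdist.not_gt (hclose hm hσ hw hgood.1 hgood.2 hnoise)
    · calc _ ≤ C * (3 * (1 / m + m / (D + 2 : ℕ) + (D + 2 : ℕ) / n)) := by gcongr
        _ = 3 * C * (1 / m + m / (D + 2 : ℕ) + (D + 2 : ℕ) / n) := by ring
        _ ≤ _ := by gcongr; exact le_add_of_nonneg_right (by positivity)
  · have := isProbabilityMeasure_trialLaw (n := n) (D := D) hm σ₁ σξ p
    refine prob_le_one.trans (ENNReal.one_le_ofReal.2 ?_)
    calc 1 ≤ r / lam * (m / D) / η := (one_le_div hη).2 hnoise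
      _ = r / (lam * η) * (m / D) := by field_simp
      _ ≤ (C + r / (lam * η)) * (3 * (1 / m + m / (D + 2 : ℕ) + (D + 2 : ℕ) / n)) := by
        gcongr
        · exact le_add_of_nonneg_left hC
        · refine le_trans ?_ hrate
          rw [add_right_comm]
          exact le_add_of_nonneg_left (by positivity)
      _ = _ := by ring

end Tail

section Convergence

variable {Ω E : Type*} [MeasurableSpace Ω] {P : Measure Ω} [PseudoMetricSpace E]
  {X : ℕ → Ω → E} {Z : Ω → E} {ρ : ℕ → ℝ}

theorem tendstoInMeasure_of_measure_le_dist_le (hρ : Tendsto ρ atTop (𝓝 0))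
    (htail : ∀ ε > 0, ∃ C, ∀ᶠ k in atTop,
      P {ω | ε ≤ dist (X k ω) (Z ω)} ≤ ENNReal.ofReal (C * ρ k)) :
    TendstoInMeasure P X atTop Z := by
  rw [tendstoInMeasure_iff_dist]
  intro ε hε
  obtain ⟨C, hC⟩ := htail ε hε
  refine tendsto_of_tendsto_of_tendsto_of_le_of_le' tendsto_const_nhds ?_
    (.of_forall fun _ => zero_le) hC
  simpa using ENNReal.tendsto_ofReal (hρ.const_mul C)

theorem ae_eventually_dist_lt (hρ : Summable ρ) {ε C : ℝ}
    (htail : ∀ᶠ k in atTop, P {ω | ε ≤ dist (X k ω) (Z ω)} ≤ ENNReal.ofReal (C * ρ k)) :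
    ∀ᵐ ω ∂P, ∀ᶠ k in atTop, dist (X k ω) (Z ω) < ε := by
  obtain ⟨k₀, hk₀⟩ := eventually_atTop.1 htail
  have hsum : ∑' k, P {ω | ε ≤ dist (X (k + k₀) ω) (Z ω)} ≠ ∞ :=
    ne_top_of_le_ne_top (((summable_nat_add_iff k₀).2 hρ).mul_left C).tsum_ofReal_ne_top
      (ENNReal.tsum_le_tsum fun k => hk₀ _ (Nat.le_add_left k₀ k))
  filter_upwards [ae_eventually_notMem hsum] with ω hω
  rw [← map_add_atTop_eq_nat k₀, eventually_map]
  simpa only [Set.mem_ofPred_eq, not_le] using hω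

theorem ae_tendsto_of_measure_le_dist_le (hρ : Summable ρ)
    (htail : ∀ ε > 0, ∃ C, ∀ᶠ k in atTop,
      P {ω | ε ≤ dist (X k ω) (Z ω)} ≤ ENNReal.ofReal (C * ρ k)) :
    ∀ᵐ ω ∂P, Tendsto (X · ω) atTop (𝓝 (Z ω)) := by
  have hdist (j : ℕ) : ∀ᵐ ω ∂P, ∀ᶠ k in atTop, dist (X k ω) (Z ω) < 1 / ((j : ℝ) + 1) :=
    let ⟨_, hC⟩ := htail _ (by positivity)
    ae_eventually_dist_lt hρ hC
  filter_upwards [ae_all_iff.2 hdist] with ω hω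
  refine Metric.tendsto_nhds.2 fun ε hε => ?_
  obtain ⟨j, hj⟩ := exists_nat_one_div_lt hε
  exact (hω j).mono fun k hk => hk.trans hj

end Convergence

theorem eventually_le_of_tendsto_div_atTop {u v : ℕ → ℕ}
    (huv : Tendsto (fun k => (v k : ℝ) / u k) atTop atTop) : ∀ᶠ k in atTop, u k ≤ v k := by
  filter_upwards [huv.eventually_ge_atTop 1] with k hk
  have hpos : 0 < (u k : ℝ) := by
    by_contra! h
    have : (u k : ℝ) = 0 := h.antisymm (Nat.cast_nonneg _)
    norm_num [this] at hk
  exact_mod_cast (one_le_div hpos).1 hk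

theorem tendsto_rate_zero {n d m : ℕ → ℕ} (hm : Tendsto m atTop atTop)
    (hdm : Tendsto (fun k => (d k : ℝ) / m k) atTop atTop)
    (hnd : Tendsto (fun k => (n k : ℝ) / d k) atTop atTop) :
    Tendsto (fun k => 1 / (m k : ℝ) + (m k : ℝ) / d k + (d k : ℝ) / n k) atTop (𝓝 0) := by
  have hm' := (tendsto_natCast_atTop_atTop (R := ℝ)).comp hm
  simpa [Pi.inv_def] using
    (hm'.inv_tendsto_atTop.add hdm.inv_tendsto_atTop).add hnd.inv_tendsto_atTop

end Dispel

theorem theorem1_general (s p r lam μ : ℝ) (σ₁ : ℝ≥0) (hp : p ∈ Set.Icc (0 : ℝ) 1)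
    (hlam : 0 < lam) (hμ : 0 ≤ μ) (hμ1 : μ < 1) (n d m : ℕ → ℕ) (σξ : ℕ → ℝ≥0)
    (hm : Tendsto m atTop atTop) (hnd : Tendsto (fun k => (n k : ℝ) / d k) atTop atTop)
    (hdm : Tendsto (fun k => (d k : ℝ) / m k) atTop atTop)
    (hσ : ∀ k, (σξ k : ℝ) ^ 2 / m k = r)
    {Ω : Type*} [MeasurableSpace Ω] (P : Measure Ω)
    (T : ∀ k, Ω → Dispel.Trial (n k) (d k) (m k))
    (hT : ∀ k, HasLaw (T k) (Dispel.trialLaw (n k) (d k) (m k) σ₁ 0 (σξ k) p) P)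
    (w : ∀ k, Ω → Fin (d k) → ℝ)
    (hw : ∀ k ω, IsMinOn (Dispel.trainLoss s lam (T k ω)) Set.univ (w k ω)) :
    TendstoInMeasure P (fun k ω => Dispel.testLoss (d k) σ₁ 0 (σξ k) μ (w k ω)) atTop
        (fun _ => Dispel.limitLoss s p r lam σ₁) ∧
      (Summable (fun k => 1 / (m k : ℝ) + (m k : ℝ) / d k + (d k : ℝ) / n k) →
        ∀ᵐ ω ∂P, Tendsto (fun k => Dispel.testLoss (d k) σ₁ 0 (σξ k) μ (w k ω)) atTop
          (𝓝 (Dispel.limitLoss s p r lam σ₁))) := by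
  have hr : 0 ≤ r := hσ 0 ▸ by positivity
  have hd := tendsto_atTop_mono' _ (Dispel.eventually_le_of_tendsto_div_atTop hdm) hm
  have hn := tendsto_atTop_mono' _ (Dispel.eventually_le_of_tendsto_div_atTop hnd) hd
  have htail : ∀ ε > 0, ∃ C, ∀ᶠ k in atTop,
      P {ω | ε ≤ dist (Dispel.testLoss (d k) σ₁ 0 (σξ k) μ (w k ω))
        (Dispel.limitLoss s p r lam σ₁)} ≤
      ENNReal.ofReal (C * (1 / (m k : ℝ) + (m k : ℝ) / d k + (d k : ℝ) / n k)) := by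
    intro ε hε
    obtain ⟨C, hC⟩ :=
      Dispel.exists_trialLaw_le_dist_testLoss_le (s := s) σ₁ ⟨p, hp⟩ hr hlam hμ1 hε
    refine ⟨C, ?_⟩
    filter_upwards [hn.eventually_gt_atTop 0, hm.eventually_gt_atTop 0, hd.eventually_ge_atTop 3,
      Dispel.eventually_le_of_tendsto_div_atTop hdm] with k hnk hmk hdk hmdk
    refine le_trans ?_ ((hT k).map_eq ▸ hC hnk hmk hdk hmdk (hσ k))
    refine le_trans (measure_mono ?_) (Measure.le_map_apply (hT k).aemeasurable _)
    exact fun ω hω => ⟨w k ω, hw k ω, hω⟩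
  exact ⟨Dispel.tendstoInMeasure_of_measure_le_dist_le
      (Dispel.tendsto_rate_zero hm hdm hnd) htail,
    fun hsum => Dispel.ae_tendsto_of_measure_le_dist_le hsum htail⟩

theorem theorem1 (s p r lam μ : ℝ) (σ₁ : ℝ≥0)
    (hs : s ∈ Set.Icc (0 : ℝ) 1) (hp : 1 / 2 < p) (hp1 : p ≤ 1) (hr : 0 < r) (hlam : 0 < lam)
    (hμ : 0 ≤ μ) (hμ1 : μ < 1)
    -- sample sizes, dimension and noise level along the asymptotic regime
    (n d m : ℕ → ℕ) (σξ : ℕ → ℝ≥0)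
    (hn : Tendsto n atTop atTop) (hd : Tendsto d atTop atTop) (hm : Tendsto m atTop atTop)
    (hnd : Tendsto (fun k => (n k : ℝ) / d k) atTop atTop)
    (hdm : Tendsto (fun k => (d k : ℝ) / m k) atTop atTop)
    (hσ : ∀ k, (σξ k : ℝ) ^ 2 / m k = r)
    -- the training runs; nothing is assumed on their joint law for different `k`
    {Ω : Type*} [MeasurableSpace Ω] (P : Measure Ω) [IsProbabilityMeasure P]
    (T : ∀ k, Ω → Dispel.Trial (n k) (d k) (m k))
    (hT : ∀ k, HasLaw (T k) (Dispel.trialLaw (n k) (d k) (m k) σ₁ 0 (σξ k) p) P)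
    -- the trained weights
    (w : ∀ k, Ω → Fin (d k) → ℝ)
    (hw : ∀ k ω, IsMinOn (Dispel.trainLoss s lam (T k ω)) Set.univ (w k ω)) :
    TendstoInMeasure P (fun k ω => Dispel.testLoss (d k) σ₁ 0 (σξ k) μ (w k ω)) atTop
        (fun _ => Dispel.limitLoss s p r lam σ₁) ∧
      (Summable (fun k => 1 / (m k : ℝ) + (m k : ℝ) / d k + (d k : ℝ) / n k) →
        ∀ᵐ ω ∂P, Tendsto (fun k => Dispel.testLoss (d k) σ₁ 0 (σξ k) μ (w k ω)) atTop
          (𝓝 (Dispel.limitLoss s p r lam σ₁))) :=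
  theorem1_general s p r lam μ σ₁ ⟨one_half_pos.le.trans hp.le, hp1⟩ hlam hμ hμ1 n d m σξ hm hnd
    hdm hσ P T hT w hw
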